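/- There is an absolute constant $C>0$ with the following property. Let $N,n\ge 1$ be integers. Let $U_1,\dots,U_n$ be i.i.d. random matrices uniformly (Haar) distributed on the unitary group $U(N)$. Let $Y_1,\dots,Y_n,Y'_1,\dots,Y'_n$ be i.i.d. random $N\times N$ matrices, each with entries $(2N)^{-1/2}(g_{rs}+\sqrt{-1}\,g'_{rs})$, where the $g_{rs},g'_{rs}$ $(1\le r,s\le N)$ are independent real $N(0,1)$ variables. For $x,y\in M_N(\mathbb C)$ let $x\otimes\bar y$ be the operator $\xi\mapsto x\xi y^*$ on $M_N(\mathbb C)$ equipped with the Hilbert–Schmidt norm, and let $P$ be the orthogonal projection of this Hilbert space onto the multiples of the identity matrix. For $1\le q\le\infty$ let $\|x\|_q=(\mathrm{tr}\,|x|^q)^{1/q}$ be the Schatten $q$-norm (the operator norm if $q=\infty$). Then for every real $p\ge 1$, every $1\le q\le\infty$ and all $a_1,\dots,a_n\in\mathbb C$, $$\mathbb E\Big\|\sum_{j=1}^n a_j\,(U_j\otimes\bar U_j)(1-P)\Big\|_q^p\le C^p\,\mathbb E\Big\|\sum_{j=1}^n a_j\,Y_j\otimes\bar Y'_j\Big\|_q^p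 ,$$ where both expectations are finite. More generally, with the same $C$, for every $k\ge 1$ and all $a_1,\dots,a_n\in M_k(\mathbb C)$, $$\mathbb E\Big\|\sum_{j=1}^n a_j\otimes\big((U_j\otimes\bar U_j)(1-P)\big)\Big\|_q^p\le C^p\,\mathbb E\Big\|\sum_{j=1}^n a_j\otimes Y_j\otimes\bar Y'_j\Big\|_q^p ,$$ again with both expectations finite. -/

import Mathlib

open MeasureTheory ProbabilityTheory
open scoped ENNReal Kronecker

noncomputable section

namespace RandomUnitary

/-- The Borel sigma-algebra on matrices. -/
instance instMeasurableSpaceMatrix {m n : Type*} : MeasurableSpace (Matrix m n ℂ) :=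
  borel (Matrix m n ℂ)

instance instBorelSpaceMatrix {m n : Type*} : BorelSpace (Matrix m n ℂ) := ⟨rfl⟩

instance instCompactSpaceUnitaryGroup (N : ℕ) :
    CompactSpace (Matrix.unitaryGroup (Fin N) ℂ) := by
  refine (isCompact_iff_compactSpace
    (s := (Matrix.unitaryGroup (Fin N) ℂ : Set (Matrix (Fin N) (Fin N) ℂ)))).mp ?_
  have hK : IsCompact (Set.pi Set.univ fun _ : Fin N =>
      Set.pi Set.univ fun _ : Fin N => Metric.closedBall (0 : ℂ) 1) :=
    isCompact_univ_pi fun _ => isCompact_univ_pi fun _ => isCompact_closedBall _ _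
  have hc : IsClosed ((Matrix.unitaryGroup (Fin N) ℂ : Set (Matrix (Fin N) (Fin N) ℂ))) := by
    have : ((Matrix.unitaryGroup (Fin N) ℂ : Set (Matrix (Fin N) (Fin N) ℂ)))
        = {A | A * star A = 1} := by
      ext A
      exact Matrix.mem_unitaryGroup_iff
    rw [this]
    exact isClosed_eq (by fun_prop) continuous_const
  refine IsCompact.of_isClosed_subset (X := Matrix (Fin N) (Fin N) ℂ) hK hc ?_
  intro A hA i _ j _
  simpa using entry_norm_bound_of_unitary hA i j

/-- The uniform distribution on the unitary group `U(N)`: the Haar measure of total mass one. -/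
def haarUnitary (N : ℕ) : Measure (Matrix.unitaryGroup (Fin N) ℂ) :=
  Measure.haarMeasure ⊤

/-- The law of the Gaussian random matrix `Y` whose entries are
`Y i j = (2N)^(-1/2) (g i j + √-1 g' i j)`, where all `g i j`, `g' i j` are independent standard
normal variables. -/
def gaussianMatrixLaw (N : ℕ) : Measure (Matrix (Fin N) (Fin N) ℂ) :=
  (Measure.pi fun _ : Fin N × Fin N => (gaussianReal 0 1).prod (gaussianReal 0 1)).map
    fun g => Matrix.of fun i j =>
      (((√(2 * (N : ℝ)))⁻¹ : ℝ) : ℂ) * (((g (i, j)).1 : ℂ) + Complex.I * ((g (i, j)).2 : ℂ))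

section Schatten

open scoped MatrixOrder

/-- The Schatten `q`-norm `‖x‖_q = (tr |x|^q)^(1/q)`, where `|x| = (x* x)^(1/2)`; for `q = ∞` it is
the operator norm on the Euclidean space. -/
def schattenNorm {m : Type*} [Fintype m] [DecidableEq m] (q : ℝ≥0∞) (x : Matrix m m ℂ) : ℝ :=
  if q = ∞ then ‖Matrix.toEuclideanCLM (n := m) (𝕜 := ℂ) x‖
  else (Matrix.trace (cfc (fun t : ℝ => t ^ q.toReal) (CFC.abs x))).re ^ (1 / q.toReal)

end Schatten

/-- `x ⊗ ȳ`, as a matrix indexed by pairs. A vector indexed by pairs is an element `ξ` of `S_2^N`,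
and `x ⊗ ȳ` acts on it as `ξ ↦ x ξ y*`. -/
def tensorConj {N : ℕ} (x y : Matrix (Fin N) (Fin N) ℂ) :
    Matrix (Fin N × Fin N) (Fin N × Fin N) ℂ :=
  x ⊗ₖ y.map star

/-- The identity matrix, as a vector of `S_2^N`. -/
def idVec (N : ℕ) : Fin N × Fin N → ℂ := fun r => (1 : Matrix (Fin N) (Fin N) ℂ) r.1 r.2

/-- The orthogonal projection of `S_2^N` onto the multiples of the identity,
`ξ ↦ N⁻¹ ⟨1, ξ⟩ 1 = N⁻¹ (tr ξ) 1`. -/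
def projId (N : ℕ) : Matrix (Fin N × Fin N) (Fin N × Fin N) ℂ :=
  (N : ℂ)⁻¹ • Matrix.vecMulVec (idVec N) (star (idVec N))

/-- `x ⊗ ȳ` acts on `S_2^N` as `ξ ↦ x ξ y*`. -/
theorem tensorConj_mulVec {N : ℕ} (x y ξ : Matrix (Fin N) (Fin N) ℂ) :
    (tensorConj x y).mulVec (fun r => ξ r.1 r.2) = fun r => (x * ξ * y.conjTranspose) r.1 r.2 := by
  ext ⟨i, i'⟩
  simp only [tensorConj, Matrix.mulVec, dotProduct, Fintype.sum_prod_type, Matrix.mul_apply,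
    Matrix.kroneckerMap_apply, Matrix.map_apply, Matrix.conjTranspose_apply, Finset.sum_mul]
  rw [Finset.sum_comm]
  exact Finset.sum_congr rfl fun _ _ => Finset.sum_congr rfl fun _ _ => by ring

/-- `P` maps `ξ` to `N⁻¹ (tr ξ) 1`. -/
theorem projId_mulVec {N : ℕ} (ξ : Matrix (Fin N) (Fin N) ℂ) :
    (projId N).mulVec (fun r => ξ r.1 r.2) =
      fun r => (((N : ℂ)⁻¹ * ξ.trace) • (1 : Matrix (Fin N) (Fin N) ℂ)) r.1 r.2 := by
  ext ⟨i, i'⟩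
  simp [projId, idVec, Matrix.mulVec, dotProduct, Fintype.sum_prod_type, Matrix.vecMulVec_apply,
    Matrix.one_apply, Matrix.trace, Finset.mul_sum]

end RandomUnitary

end

open RandomUnitary

/-!
Write `B(x, y)ᵢ = xᵢ ⊗ ȳᵢ` and let `Y`, `Y'` be independent Gaussian tuples, so that
`𝔼 B(Y, Y) = (P, …, P)` is killed by `1 - P`. Conditioning on `Y`, Jensen's inequality compares
`B(Y, Y) - 𝔼 B(Y, Y)` with `B(Y, Y) - B(Y', Y')`, and the Gaussian rotation by `π / 4` turns the
latter into `B(Y, Y') + B(Y', Y)`; this costs a factor `2`.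

By the polar decomposition, `Y` has the law of `U|Y|` with `U` Haar distributed and independent of
`|Y|`. Averaging over `|Y|` replaces `(Y ⊗ Ȳ)(1 - P)` by `(U ⊗ Ū) M (1 - P)` with
`M = 𝔼 |Y| ⊗ |Y|‾`, and Jensen's inequality says that this decreases moments of norms. Unitary
invariance makes `M` commute with every `V ⊗ V̄`, hence `M (1 - P) = c (1 - P)` with
`c = (𝔼 (tr |Y|)² - 1) / (N² - 1)` for `N ≥ 2`. Finally `𝔼 tr Y*Y = N` and `𝔼 tr (Y*Y)² = 2 N` bound
`𝔼 tr |Y|` from below by `19 N / 27`, whence `c ≥ 1 / 4`, and the constant is `2 · 4 = 8`.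
-/

noncomputable section

namespace RandomUnitary

section SingularValues

theorem exists_linearIsometry_comp_eq {𝕜 E F : Type*} [RCLike 𝕜] [AddCommGroup E] [Module 𝕜 E]
    [NormedAddCommGroup F] [InnerProductSpace 𝕜 F] [FiniteDimensional 𝕜 F] {f g : E →ₗ[𝕜] F}
    (h : ∀ x, ‖f x‖ = ‖g x‖) : ∃ W : F →ₗᵢ[𝕜] F, ∀ x, W (g x) = f x := by
  have hker : LinearMap.ker g ≤ LinearMap.ker f := fun x hx => by
    rw [LinearMap.mem_ker] at hx ⊢
    rw [← norm_eq_zero, h, hx, norm_zero]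
  let L₀ : LinearMap.range g →ₗ[𝕜] F :=
    (LinearMap.ker g).liftQ f hker ∘ₗ g.quotKerEquivRange.symm.toLinearMap
  have hL₀ : ∀ x, L₀ ⟨g x, g.mem_range_self x⟩ = f x := fun x => by
    simp [L₀, LinearMap.quotKerEquivRange_symm_apply_image]
  let L : LinearMap.range g →ₗᵢ[𝕜] F := ⟨L₀, by
    rintro ⟨_, x, rfl⟩
    rw [hL₀, h, Submodule.coe_norm]⟩
  exact ⟨L.extend, fun x => (L.extend_apply ⟨g x, g.mem_range_self x⟩).trans (hL₀ x)⟩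

variable {m : Type*} [Fintype m] [DecidableEq m]

theorem exists_unitary_mul_of_star_mul_self_eq {A B : Matrix m m ℂ}
    (h : star A * A = star B * B) : ∃ w ∈ Matrix.unitaryGroup m ℂ, A = w * B := by
  let e := Matrix.toEuclideanCLM (n := m) (𝕜 := ℂ)
  have norm_sq (C : Matrix m m ℂ) (x : EuclideanSpace ℂ m) :
      inner ℂ (e (star C * C) x) x = (‖e C x‖ : ℂ) ^ 2 := by
    rw [map_mul, map_star, ContinuousLinearMap.star_eq_adjoint, mul_apply_eq_comp,
      ContinuousLinearMap.adjoint_inner_left, inner_self_eq_norm_sq_to_K]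
    rfl
  have norm_eq (x : EuclideanSpace ℂ m) : ‖e A x‖ = ‖e B x‖ := by
    have := (norm_sq A x).symm.trans (h ▸ norm_sq B x)
    exact (sq_eq_sq₀ (norm_nonneg _) (norm_nonneg _)).mp (by exact_mod_cast this)
  obtain ⟨W, hW⟩ := exists_linearIsometry_comp_eq (f := (e A).toLinearMap)
    (g := (e B).toLinearMap) norm_eq
  obtain ⟨w, hw⟩ := EquivLike.surjective e W.toContinuousLinearMap
  refine ⟨w, Matrix.mem_unitaryGroup_iff'.mpr (EquivLike.injective e ?_),
    EquivLike.injective e ?_⟩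
  · rw [map_mul, map_star, hw, map_one, ContinuousLinearMap.star_eq_adjoint]
    exact (ContinuousLinearMap.norm_map_iff_adjoint_comp_self _).mp W.norm_map
  · rw [map_mul, hw]
    exact ContinuousLinearMap.ext fun x => (hW x).symm

open scoped MatrixOrder in
theorem exists_unitary_mul_abs (x : Matrix m m ℂ) :
    ∃ w ∈ Matrix.unitaryGroup m ℂ, x = w * CFC.abs x := by
  refine exists_unitary_mul_of_star_mul_self_eq ?_
  rw [(CFC.abs_nonneg x).isSelfAdjoint.star_eq, CFC.abs_mul_abs]

open scoped MatrixOrder ComplexOrder in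
theorem exists_singular_value_decomposition (x : Matrix m m ℂ) :
    ∃ u ∈ Matrix.unitaryGroup m ℂ, ∃ v ∈ Matrix.unitaryGroup m ℂ, ∃ s : m → ℝ, (∀ i, 0 ≤ s i) ∧
      x = u * Matrix.diagonal (fun i => (s i : ℂ)) * v ∧
      ∀ f : ℝ → ℝ, (cfc f (CFC.abs x)).trace = ∑ i, (f (s i) : ℂ) := by
  obtain ⟨w, hw, hx⟩ := exists_unitary_mul_abs x
  have hpos : (CFC.abs x).PosSemidef := Matrix.nonneg_iff_posSemidef.mp (CFC.abs_nonneg x)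
  have hH := hpos.isHermitian
  refine ⟨w * hH.eigenvectorUnitary, mul_mem hw hH.eigenvectorUnitary.2,
    star (hH.eigenvectorUnitary : Matrix m m ℂ), (star hH.eigenvectorUnitary).2,
    hH.eigenvalues, hpos.eigenvalues_nonneg, ?_, fun f => ?_⟩
  · conv_lhs => rw [hx, hH.spectral_theorem]
    simp [Unitary.conjStarAlgAut_apply, mul_assoc, Function.comp_def]
  · rw [hH.cfc_eq, Matrix.IsHermitian.cfc, Unitary.conjStarAlgAut_apply, Matrix.trace_mul_comm,
      ← mul_assoc]
    simp [Matrix.trace_diagonal]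

end SingularValues

section SchattenNorm

section LpNorm

variable {m : Type*} [Fintype m] (q : ℝ≥0∞) [Fact (1 ≤ q)]

theorem norm_toLp_le_norm_toLp {E F : Type*} [SeminormedAddCommGroup E]
    [SeminormedAddCommGroup F] {x : m → E} {y : m → F} (h : ∀ i, ‖x i‖ ≤ ‖y i‖) :
    ‖WithLp.toLp q x‖ ≤ ‖WithLp.toLp q y‖ := by
  rcases eq_or_ne q ∞ with rfl | hq
  · simp only [PiLp.norm_eq_ciSup]
    exact ciSup_mono (Set.finite_range _).bddAbove h
  · have hq₀ : 0 < q.toReal := ENNReal.toReal_pos (zero_lt_one.trans_le Fact.out).ne' hq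
    simp only [PiLp.norm_eq_sum hq₀]
    gcongr with i
    exact h i

theorem norm_toLp_mulVec_le_of_mem_doublyStochastic [DecidableEq m] {D : Matrix m m ℝ}
    (hD : D ∈ doublyStochastic ℝ m) (s : m → ℝ) :
    ‖WithLp.toLp q (D.mulVec s)‖ ≤ ‖WithLp.toLp q s‖ := by
  let T : Matrix m m ℝ →ₗ[ℝ] PiLp q fun _ : m => ℝ :=
    (WithLp.linearEquiv q ℝ (m → ℝ)).symm.toLinearMap ∘ₗ (Matrix.mulVecBilin ℝ ℝ).flip s
  rw [← SetLike.mem_coe, doublyStochastic_eq_convexHull_permMatrix] at hD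
  obtain ⟨_, ⟨σ, rfl⟩, hσ⟩ :=
    (convexOn_univ_norm.comp_linearMap T).exists_ge_of_mem_convexHull (Set.subset_univ _) hD
  refine hσ.trans_eq ?_
  have : T (σ.permMatrix ℝ) =
      LinearIsometryEquiv.piLpCongrLeft q ℝ ℝ σ.symm (WithLp.toLp q s) := by
    ext i
    simp [T, Matrix.permMatrix_mulVec, LinearIsometryEquiv.piLpCongrLeft_apply]
  exact (congrArg norm this).trans (LinearIsometryEquiv.norm_map _ _)

end LpNorm

variable {m : Type*} [Fintype m] [DecidableEq m]

theorem sum_norm_sq_row_of_mem_unitaryGroup {u : Matrix m m ℂ} (hu : u ∈ Matrix.unitaryGroup m ℂ)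
    (i : m) : ∑ k, ‖u i k‖ ^ 2 = 1 := by
  have h := congrFun₂ (Matrix.mem_unitaryGroup_iff.mp hu) i i
  simp only [Matrix.mul_apply, Matrix.star_apply, Matrix.one_apply_eq, RCLike.star_def,
    Complex.mul_conj'] at h
  exact_mod_cast h

theorem sum_norm_sq_col_of_mem_unitaryGroup {u : Matrix m m ℂ} (hu : u ∈ Matrix.unitaryGroup m ℂ)
    (k : m) : ∑ i, ‖u i k‖ ^ 2 = 1 := by
  simpa using sum_norm_sq_row_of_mem_unitaryGroup (Unitary.star_mem hu) k

theorem average_normSq_mem_doublyStochastic {u v : Matrix m m ℂ}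
    (hu : u ∈ Matrix.unitaryGroup m ℂ) (hv : v ∈ Matrix.unitaryGroup m ℂ) :
    Matrix.of (fun i k => (‖u i k‖ ^ 2 + ‖v k i‖ ^ 2) / 2) ∈ doublyStochastic ℝ m := by
  refine mem_doublyStochastic_iff_sum.mpr ⟨fun i k => ?_, fun i => ?_, fun k => ?_⟩
  · rw [Matrix.of_apply]
    positivity
  all_goals
    simp [← Finset.sum_div, Finset.sum_add_distrib, sum_norm_sq_row_of_mem_unitaryGroup, hu, hv,
      sum_norm_sq_col_of_mem_unitaryGroup]

theorem norm_mul_diagonal_mul_apply_self_le (u v : Matrix m m ℂ) {s : m → ℝ} (hs : ∀ i, 0 ≤ s i)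
    (i : m) : ‖(u * Matrix.diagonal (fun i => (s i : ℂ)) * v) i i‖ ≤
      ((Matrix.of fun i k => (‖u i k‖ ^ 2 + ‖v k i‖ ^ 2) / 2).mulVec s) i := by
  rw [Matrix.mul_apply, Matrix.mulVec, dotProduct]
  refine norm_sum_le_of_le _ fun k _ => ?_
  rw [Matrix.mul_diagonal, norm_mul, norm_mul, Complex.norm_of_nonneg (hs k), Matrix.of_apply]
  linarith [mul_nonneg (hs k) (sq_nonneg (‖u i k‖ - ‖v k i‖))]

variable {q : ℝ≥0∞} [Fact (1 ≤ q)]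

theorem norm_diag_mul_diagonal_mul_le {u v : Matrix m m ℂ} (hu : u ∈ Matrix.unitaryGroup m ℂ)
    (hv : v ∈ Matrix.unitaryGroup m ℂ) {s : m → ℝ} (hs : ∀ i, 0 ≤ s i) :
    ‖WithLp.toLp q (u * Matrix.diagonal (fun i => (s i : ℂ)) * v).diag‖ ≤ ‖WithLp.toLp q s‖ :=
  (norm_toLp_le_norm_toLp q fun i => (norm_mul_diagonal_mul_apply_self_le u v hs i).trans
    (Real.le_norm_self _)).trans
    (norm_toLp_mulVec_le_of_mem_doublyStochastic q (average_normSq_mem_doublyStochastic hu hv) s)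

open scoped Matrix.Norms.L2Operator in
theorem exists_schattenNorm_eq_norm_singular_values (x : Matrix m m ℂ) :
    ∃ u ∈ Matrix.unitaryGroup m ℂ, ∃ v ∈ Matrix.unitaryGroup m ℂ, ∃ s : m → ℝ, (∀ i, 0 ≤ s i) ∧
      x = u * Matrix.diagonal (fun i => (s i : ℂ)) * v ∧
      schattenNorm q x = ‖WithLp.toLp q s‖ := by
  obtain ⟨u, hu, v, hv, s, hs, hx, htrace⟩ := exists_singular_value_decomposition x
  refine ⟨u, hu, v, hv, s, hs, hx, ?_⟩
  rcases eq_or_ne q ∞ with rfl | hq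
  · let e := Matrix.toEuclideanCLM (n := m) (𝕜 := ℂ)
    rw [schattenNorm, if_pos rfl, hx, map_mul, map_mul,
      CStarRing.norm_mul_mem_unitary _ (Unitary.map_mem e hv),
      CStarRing.norm_mem_unitary_mul _ (Unitary.map_mem e hu), Matrix.l2_opNorm_toEuclideanCLM,
      Matrix.l2_opNorm_diagonal, PiLp.norm_toLp, Pi.norm_def, Pi.norm_def]
    simp
  · have hq₀ : 0 < q.toReal := ENNReal.toReal_pos (zero_lt_one.trans_le Fact.out).ne' hq
    rw [schattenNorm, if_neg hq, htrace, PiLp.norm_eq_sum hq₀]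
    simp [abs_of_nonneg (hs _)]

theorem norm_diag_mul_mul_le_schattenNorm (x : Matrix m m ℂ) {u v : Matrix m m ℂ}
    (hu : u ∈ Matrix.unitaryGroup m ℂ) (hv : v ∈ Matrix.unitaryGroup m ℂ) :
    ‖WithLp.toLp q (u * x * v).diag‖ ≤ schattenNorm q x := by
  obtain ⟨u', hu', v', hv', s, hs, hx, hnorm⟩ :=
    exists_schattenNorm_eq_norm_singular_values (q := q) x
  have : u * x * v = u * u' * Matrix.diagonal (fun i => (s i : ℂ)) * (v' * v) := by
    simp only [hx, mul_assoc]
  rw [this, hnorm]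
  exact norm_diag_mul_diagonal_mul_le (mul_mem hu hu') (mul_mem hv' hv) hs

theorem exists_schattenNorm_eq_norm_diag (x : Matrix m m ℂ) :
    ∃ u ∈ Matrix.unitaryGroup m ℂ, ∃ v ∈ Matrix.unitaryGroup m ℂ,
      schattenNorm q x = ‖WithLp.toLp q (u * x * v).diag‖ := by
  obtain ⟨u, hu, v, hv, s, -, hx, hnorm⟩ :=
    exists_schattenNorm_eq_norm_singular_values (q := q) x
  refine ⟨star u, Unitary.star_mem hu, star v, Unitary.star_mem hv, ?_⟩
  have : star u * x * star v = Matrix.diagonal fun i => (s i : ℂ) := by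
    rw [hx, ← mul_assoc, ← mul_assoc, Unitary.star_mul_self_of_mem hu, one_mul, mul_assoc,
      Unitary.mul_star_self_of_mem hv, mul_one]
  rw [hnorm, this, Matrix.diag_diagonal]
  exact le_antisymm (norm_toLp_le_norm_toLp q fun i => (Complex.norm_real _).ge)
    (norm_toLp_le_norm_toLp q fun i => (Complex.norm_real _).le)

theorem schattenNorm_add_le (x y : Matrix m m ℂ) :
    schattenNorm q (x + y) ≤ schattenNorm q x + schattenNorm q y := by
  obtain ⟨u, hu, v, hv, h⟩ := exists_schattenNorm_eq_norm_diag (q := q) (x + y)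
  rw [h, mul_add, add_mul, Matrix.diag_add, WithLp.toLp_add]
  exact norm_add_le_of_le (norm_diag_mul_mul_le_schattenNorm x hu hv)
    (norm_diag_mul_mul_le_schattenNorm y hu hv)

theorem schattenNorm_smul_le (c : ℂ) (x : Matrix m m ℂ) :
    schattenNorm q (c • x) ≤ ‖c‖ * schattenNorm q x := by
  obtain ⟨u, hu, v, hv, h⟩ := exists_schattenNorm_eq_norm_diag (q := q) (c • x)
  rw [h, mul_smul_comm, smul_mul_assoc, Matrix.diag_smul, WithLp.toLp_smul, norm_smul]
  gcongr
  exact norm_diag_mul_mul_le_schattenNorm x hu hv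

theorem schattenNorm_zero : schattenNorm q (0 : Matrix m m ℂ) = 0 := by
  obtain ⟨u, -, v, -, h⟩ := exists_schattenNorm_eq_norm_diag (q := q) (0 : Matrix m m ℂ)
  simpa using h

theorem schattenNorm_mul_unitary_le (x : Matrix m m ℂ) {w : Matrix m m ℂ}
    (hw : w ∈ Matrix.unitaryGroup m ℂ) : schattenNorm q (x * w) ≤ schattenNorm q x := by
  obtain ⟨u, hu, v, hv, h⟩ := exists_schattenNorm_eq_norm_diag (q := q) (x * w)
  rw [h, ← mul_assoc, mul_assoc]
  exact norm_diag_mul_mul_le_schattenNorm x hu (mul_mem hw hv)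

theorem schattenNorm_mul_le_of_isStarProjection (x : Matrix m m ℂ) {e : Matrix m m ℂ}
    (he : IsStarProjection e) : schattenNorm q (x * e) ≤ schattenNorm q x := by
  have hx : x * e = (1 / 2 : ℂ) • (x + x * (2 * e - 1)) := by
    rw [mul_sub, mul_one, add_sub_cancel, ← mul_assoc, mul_two, add_mul, ← two_smul ℂ, smul_smul]
    norm_num
  have hw := schattenNorm_mul_unitary_le (q := q) x he.two_mul_sub_one_mem_unitary
  calc schattenNorm q (x * e)
      ≤ ‖(1 / 2 : ℂ)‖ * schattenNorm q (x + x * (2 * e - 1)) := hx ▸ schattenNorm_smul_le _ _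
    _ ≤ 1 / 2 * (schattenNorm q x + schattenNorm q x) := by
        rw [norm_div, norm_one, Complex.norm_ofNat]
        gcongr
        exact (schattenNorm_add_le _ _).trans (by gcongr)
    _ = schattenNorm q x := by ring

/-- The Schatten `q`-norm as a seminorm on the square complex matrices. -/
def schattenSeminorm (q : ℝ≥0∞) [Fact (1 ≤ q)] (m : Type*) [Fintype m] [DecidableEq m] :
    Seminorm ℂ (Matrix m m ℂ) :=
  Seminorm.ofSMulLE (schattenNorm q) schattenNorm_zero schattenNorm_add_le schattenNorm_smul_le

end SchattenNorm

section Schur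

theorem exists_eq_ite_of_perm_invariant {n R : Type*} [DecidableEq n] [Nonempty R] {f : n → n → R}
    (hf : ∀ (σ : Equiv.Perm n) i j, f (σ i) (σ j) = f i j) :
    ∃ a b, ∀ i j, f i j = if i = j then a else b := by
  have exists_const (p : n → n → Prop) (h : ∀ i j k l, p i j → p k l → f i j = f k l) :
      ∃ a, ∀ i j, p i j → f i j = a := by
    by_cases hp : ∃ k l, p k l
    · obtain ⟨k, l, hkl⟩ := hp
      exact ⟨f k l, fun i j hij => h i j k l hij hkl⟩
    · exact ⟨Classical.arbitrary R, fun i j hij => (hp ⟨i, j, hij⟩).elim⟩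
  obtain ⟨a, ha⟩ := exists_const (· = ·) <| by
    rintro i _ k _ rfl rfl
    simpa using hf (Equiv.swap k i) k k
  obtain ⟨b, hb⟩ := exists_const (· ≠ ·) fun i j k l hij hkl => by
    obtain ⟨σ, hσi, hσj⟩ := MulAction.is_two_pretransitive_iff.mp
      (Equiv.Perm.isMultiplyPretransitive n 2) hkl hij
    rw [← hf σ k l, ← Equiv.Perm.smul_def, ← Equiv.Perm.smul_def, hσi, hσj]
  exact ⟨a, b, fun i j => by split_ifs with h; exacts [ha i j h, hb i j h]⟩

section Equivariant

variable {n : Type*} [Fintype n] [DecidableEq n]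

theorem permMatrix_mul_mul_star (σ : Equiv.Perm n) (ξ : Matrix n n ℂ) :
    σ.permMatrix ℂ * ξ * star (σ.permMatrix ℂ) = ξ.submatrix σ σ := by
  rw [Matrix.star_eq_conjTranspose, Matrix.conjTranspose_permMatrix, Equiv.Perm.permMatrix,
    Equiv.Perm.permMatrix, PEquiv.toMatrix_toPEquiv_mul, PEquiv.mul_toMatrix_toPEquiv]
  rfl

theorem permMatrix_mem_unitaryGroup (σ : Equiv.Perm n) :
    σ.permMatrix ℂ ∈ Matrix.unitaryGroup n ℂ := by
  simpa [Matrix.mem_unitaryGroup_iff, Matrix.submatrix_one_equiv] using permMatrix_mul_mul_star σ 1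

theorem diagonal_mem_unitaryGroup {θ : n → ℂ} (hθ : ∀ i, ‖θ i‖ = 1) :
    Matrix.diagonal θ ∈ Matrix.unitaryGroup n ℂ := by
  simp [Matrix.mem_unitaryGroup_iff, Matrix.star_eq_conjTranspose, Matrix.diagonal_conjTranspose,
    Complex.mul_conj', hθ]

variable {Φ : Matrix n n ℂ →ₗ[ℂ] Matrix n n ℂ}
  (hΦ : ∀ V ∈ Matrix.unitaryGroup n ℂ, ∀ ξ, Φ (V * ξ * star V) = V * Φ ξ * star V)

include hΦ

theorem exists_map_single_eq_of_unitary_equivariant :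
    ∃ a b : ℂ, ∀ i, Φ (Matrix.single i i 1) = a • Matrix.single i i 1 + b • 1 := by
  have off_diag (i j k : n) (hjk : j ≠ k) : Φ (Matrix.single i i 1) j k = 0 := by
    let θ : n → ℂ := Function.update 1 j (-1)
    have hθ (l : n) : ‖θ l‖ = 1 := by
      rcases eq_or_ne l j with rfl | h <;> simp [θ, *]
    have hfix : Matrix.diagonal θ * Matrix.single i i 1 * star (Matrix.diagonal θ) =
        Matrix.single i i (1 : ℂ) := by
      ext k l
      by_cases h : i = k ∧ i = l
      · simp [Matrix.star_eq_conjTranspose, Matrix.diagonal_conjTranspose, ← h.1, ← h.2,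
          Complex.mul_conj', hθ]
      · simp [Matrix.star_eq_conjTranspose, Matrix.diagonal_conjTranspose, h]
    have h := congrFun₂ (hΦ _ (diagonal_mem_unitaryGroup hθ) (Matrix.single i i 1)) j k
    rw [hfix, Matrix.star_eq_conjTranspose, Matrix.diagonal_conjTranspose, Matrix.mul_diagonal,
      Matrix.diagonal_mul] at h
    simpa [θ, hjk.symm, self_eq_neg] using h
  obtain ⟨a, b, hab⟩ := exists_eq_ite_of_perm_invariant
    (f := fun i j => Φ (Matrix.single i i 1) j j) fun σ i j => by
      have h := hΦ _ (permMatrix_mem_unitaryGroup σ) (Matrix.single (σ i) (σ i) 1)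
      rw [permMatrix_mul_mul_star, permMatrix_mul_mul_star,
        Matrix.submatrix_single_equiv, Equiv.symm_apply_apply] at h
      exact (congrFun₂ h j j).symm
  refine ⟨a - b, b, fun i => Matrix.ext fun j k => ?_⟩
  rcases eq_or_ne j k with rfl | hjk
  · rw [hab]
    by_cases hij : i = j <;> simp [hij]
  · have : ¬(i = j ∧ i = k) := fun h => hjk (h.1.symm.trans h.2)
    simp [off_diag i j k hjk, this, hjk]

theorem eq_zero_of_unitary_equivariant_of_map_single
    (h₀ : ∀ i, Φ (Matrix.single i i 1) = 0) : Φ = 0 := by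
  have map_diagonal (d : n → ℂ) : Φ (Matrix.diagonal d) = 0 := by
    have : Matrix.diagonal d = ∑ i, d i • Matrix.single i i (1 : ℂ) := by
      ext j k
      simp [Matrix.sum_apply, Matrix.single_apply, Matrix.diagonal_apply, ite_and]
    simp only [this, map_sum, map_smul, h₀, smul_zero, Finset.sum_const_zero]
  have map_hermitian {H : Matrix n n ℂ} (hH : H.IsHermitian) : Φ H = 0 := by
    rw [hH.spectral_theorem, Unitary.conjStarAlgAut_apply, hΦ _ hH.eigenvectorUnitary.2,
      map_diagonal, mul_zero, zero_mul]
  refine LinearMap.ext fun ξ => ?_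
  rw [← realPart_add_I_smul_imaginaryPart ξ, map_add, map_smul, map_hermitian (realPart ξ).2,
    map_hermitian (imaginaryPart ξ).2, smul_zero, add_zero, LinearMap.zero_apply]

theorem exists_map_eq_of_unitary_equivariant :
    ∃ a b : ℂ, ∀ ξ, Φ ξ = a • ξ + (b * ξ.trace) • 1 := by
  obtain ⟨a, b, hab⟩ := exists_map_single_eq_of_unitary_equivariant hΦ
  refine ⟨a, b, fun ξ => ?_⟩
  let Ψ : Matrix n n ℂ →ₗ[ℂ] Matrix n n ℂ :=
    a • LinearMap.id + b • (Matrix.traceLinearMap n ℂ ℂ).smulRight 1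
  have hΨ (V) (hV : V ∈ Matrix.unitaryGroup n ℂ) (ξ : Matrix n n ℂ) :
      Ψ (V * ξ * star V) = V * Ψ ξ * star V := by
    have htrace : (V * ξ * star V).trace = ξ.trace := by
      rw [Matrix.trace_mul_comm, ← mul_assoc, Unitary.star_mul_self_of_mem hV, one_mul]
    simp [Ψ, mul_add, add_mul, htrace, Unitary.mul_star_self_of_mem hV]
  have hzero : Φ - Ψ = 0 := eq_zero_of_unitary_equivariant_of_map_single
    (fun V hV ξ => by simp [hΦ V hV, hΨ V hV, mul_sub, sub_mul]) fun i => by simp [hab, Ψ]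
  rw [sub_eq_zero.mp hzero]
  simp [Ψ, mul_smul]

end Equivariant

section TensorConj

variable {N : ℕ}

theorem tensorConj_apply (x y : Matrix (Fin N) (Fin N) ℂ) (r s : Fin N × Fin N) :
    tensorConj x y r s = x r.1 s.1 * star (y r.2 s.2) := rfl

theorem tensorConj_mul_tensorConj (x y x' y' : Matrix (Fin N) (Fin N) ℂ) :
    tensorConj x y * tensorConj x' y' = tensorConj (x * x') (y * y') := by
  have h : (y * y').map star = y.map star * y'.map star :=
    Matrix.map_mul (f := starRingEnd ℂ)
  rw [tensorConj, tensorConj, tensorConj, h, Matrix.mul_kronecker_mul]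

theorem tensorConj_one : tensorConj (1 : Matrix (Fin N) (Fin N) ℂ) 1 = 1 := by
  rw [tensorConj, Matrix.map_one _ (star_zero ℂ) (star_one ℂ), Matrix.one_kronecker_one]

theorem trace_tensorConj (x y : Matrix (Fin N) (Fin N) ℂ) :
    (tensorConj x y).trace = x.trace * star y.trace := by
  rw [tensorConj, Matrix.trace_kronecker]
  simp [Matrix.trace]

theorem star_idVec_dotProduct_idVec : star (idVec N) ⬝ᵥ idVec N = N := by
  simp [dotProduct, idVec, Fintype.sum_prod_type, Matrix.one_apply, apply_ite]

theorem isStarProjection_projId : IsStarProjection (projId N) where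
  isSelfAdjoint := by
    simp [IsSelfAdjoint, projId, Matrix.star_eq_conjTranspose, Matrix.conjTranspose_vecMulVec]
  isIdempotentElem := by
    rw [IsIdempotentElem, projId, smul_mul_smul_comm, Matrix.vecMulVec_mul_vecMulVec,
      star_idVec_dotProduct_idVec, Matrix.vecMulVec_smul, smul_smul, mul_assoc]
    rcases eq_or_ne (N : ℂ) 0 with hN | hN
    · simp [hN]
    · rw [inv_mul_cancel₀ hN, mul_one]

theorem trace_projId [NeZero N] : (projId N).trace = 1 := by
  rw [projId, Matrix.trace_smul, Matrix.trace_vecMulVec, dotProduct_comm,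
    star_idVec_dotProduct_idVec, smul_eq_mul, inv_mul_cancel₀ (NeZero.ne _)]

theorem trace_tensorConj_mul_projId (x y : Matrix (Fin N) (Fin N) ℂ) :
    (tensorConj x y * projId N).trace = (N : ℂ)⁻¹ * (x * star y).trace := by
  rw [projId, mul_smul_comm, Matrix.trace_smul, Matrix.mul_vecMulVec, Matrix.trace_vecMulVec]
  change _ • ((tensorConj x y).mulVec (fun r => (1 : Matrix (Fin N) (Fin N) ℂ) r.1 r.2) ⬝ᵥ _) = _
  rw [tensorConj_mulVec, smul_eq_mul, mul_one]
  simp [dotProduct, idVec, Fintype.sum_prod_type, Matrix.one_apply, apply_ite, Matrix.trace,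
    Matrix.star_eq_conjTranspose]

theorem ext_mulVec {T S : Matrix (Fin N × Fin N) (Fin N × Fin N) ℂ}
    (h : ∀ ξ : Matrix (Fin N) (Fin N) ℂ,
      T.mulVec (fun r => ξ r.1 r.2) = S.mulVec (fun r => ξ r.1 r.2)) : T = S :=
  Matrix.mulVec_injective (funext fun w => h (Matrix.of (Function.curry w)))

theorem exists_eq_smul_one_add_smul_projId {T : Matrix (Fin N × Fin N) (Fin N × Fin N) ℂ}
    (hT : ∀ V ∈ Matrix.unitaryGroup (Fin N) ℂ, Commute (tensorConj V V) T) :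
    ∃ a b : ℂ, T = a • 1 + b • projId N := by
  let Φ : Matrix (Fin N) (Fin N) ℂ →ₗ[ℂ] Matrix (Fin N) (Fin N) ℂ :=
    { toFun := fun ξ => Matrix.of (Function.curry (T.mulVec fun r => ξ r.1 r.2))
      map_add' := fun ξ η => by ext; exact congrFun (T.mulVec_add _ _) _
      map_smul' := fun c ξ => by ext; exact congrFun (T.mulVec_smul c _) _ }
  have hΦ (ξ : Matrix (Fin N) (Fin N) ℂ) :
      (T.mulVec fun r => ξ r.1 r.2) = fun r => Φ ξ r.1 r.2 := rfl
  obtain ⟨a, b, hab⟩ := exists_map_eq_of_unitary_equivariant (Φ := Φ) fun V hV ξ => by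
    ext i j
    change (fun r : Fin N × Fin N => Φ (V * ξ * star V) r.1 r.2) (i, j) =
      (fun r : Fin N × Fin N => (V * Φ ξ * star V) r.1 r.2) (i, j)
    rw [← hΦ, Matrix.star_eq_conjTranspose, ← tensorConj_mulVec, Matrix.mulVec_mulVec,
      ← (hT V hV).eq, ← Matrix.mulVec_mulVec, hΦ, tensorConj_mulVec]
  refine ⟨a, b * N, ext_mulVec fun ξ => ?_⟩
  ext ⟨i, j⟩
  have hN : (N : ℂ) ≠ 0 := Nat.cast_ne_zero.mpr i.pos.ne'
  simp [hΦ, hab, Matrix.add_mulVec, Matrix.smul_mulVec, projId_mulVec, mul_assoc, hN]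

theorem exists_mul_one_sub_projId_eq {T : Matrix (Fin N × Fin N) (Fin N × Fin N) ℂ}
    (hT : ∀ V ∈ Matrix.unitaryGroup (Fin N) ℂ, Commute (tensorConj V V) T) :
    ∃ c : ℂ, T * (1 - projId N) = c • (1 - projId N) := by
  obtain ⟨a, b, rfl⟩ := exists_eq_smul_one_add_smul_projId hT
  refine ⟨a, ?_⟩
  rw [add_mul, smul_mul_assoc, smul_mul_assoc, one_mul,
    isStarProjection_projId.isIdempotentElem.mul_one_sub_self, smul_zero, add_zero]

end TensorConj

end Schur

section Gaussian

variable {E : Type*} [NormedAddCommGroup E] [NormedSpace ℝ E] [MeasurableSpace E] [BorelSpace E]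
  [SecondCountableTopology E] [CompleteSpace E] {μ : Measure E} [IsGaussian μ]

theorem memLp_bilinear_of_isGaussian {F G H : Type*} [NormedAddCommGroup F] [NormedSpace ℝ F]
    [NormedAddCommGroup G] [NormedSpace ℝ G] [NormedAddCommGroup H] [NormedSpace ℝ H]
    (B : F →L[ℝ] G →L[ℝ] H) (S : E →L[ℝ] F) (T : E →L[ℝ] G) {r : ℝ≥0∞} (hr : r ≠ ∞) :
    MemLp (fun x => B (S x) (T x)) r μ := by
  have : ENNReal.HolderTriple (2 * r) (2 * r) r := ⟨by
    rw [ENNReal.mul_inv (.inl two_ne_zero) (.inl ENNReal.ofNat_ne_top), ← add_mul,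
      ENNReal.inv_two_add_inv_two, one_mul]⟩
  have h : MemLp id (2 * r) μ :=
    IsGaussian.memLp_id μ _ (ENNReal.mul_ne_top ENNReal.ofNat_ne_top hr)
  exact B.memLp_of_bilin r (S.comp_memLp' h) (T.comp_memLp' h)

theorem integral_comp_rotation_eq_of_isGaussian (hμ : μ[id] = 0) {G : Type*} [NormedAddCommGroup G]
    [NormedSpace ℝ G] {f : E × E → G} (hf : Continuous f) (θ : ℝ) :
    ∫ z, f (ContinuousLinearMap.rotation θ z) ∂μ.prod μ = ∫ z, f z ∂μ.prod μ := by
  rw [← integral_map (by fun_prop) hf.aestronglyMeasurable, IsGaussian.map_rotation_eq_self hμ θ]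

section Wick

variable {𝕜 : Type*} [RCLike 𝕜]

/-- `∏ Lᵢ (x + y) + ∏ Lᵢ (y - x)` only has terms of even degree in `x`. -/
theorem mul_rotation_pi_div_four {E : Type*} [NormedAddCommGroup E] [NormedSpace ℝ E]
    (L₁ L₂ L₃ L₄ : E →L[ℝ] 𝕜) {x y u v : E}
    (huv : ContinuousLinearMap.rotation (Real.pi / 4) (x, y) = (u, v)) :
    2 * ((L₁ u * L₂ u) * (L₃ u * L₄ u) + (L₁ v * L₂ v) * (L₃ v * L₄ v)) =
      (L₁ x * L₂ x) * (L₃ x * L₄ x) + (L₁ y * L₂ y) * (L₃ y * L₄ y) +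
      ((L₁ x * L₂ x) * (L₃ y * L₄ y) + (L₃ x * L₄ x) * (L₁ y * L₂ y)) +
      ((L₁ x * L₃ x) * (L₂ y * L₄ y) + (L₂ x * L₄ x) * (L₁ y * L₃ y)) +
      ((L₁ x * L₄ x) * (L₂ y * L₃ y) + (L₂ x * L₃ x) * (L₁ y * L₄ y)) := by
  have hc : 4 * ((√2 / 2 : ℝ) : 𝕜) ^ 4 = 1 := by
    have : 4 * (√2 / 2) ^ 4 = 1 := by
      linear_combination (√2 ^ 2 + 2) / 4 * Real.sq_sqrt zero_le_two
    exact_mod_cast this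
  rw [ContinuousLinearMap.rotation_apply, Real.cos_pi_div_four, Real.sin_pi_div_four,
    Prod.mk.injEq] at huv
  rw [← huv.1, ← huv.2]
  simp only [map_add, map_smul, neg_smul, map_neg, RCLike.real_smul_eq_coe_mul]
  linear_combination ((L₁ x + L₁ y) * (L₂ x + L₂ y) * (L₃ x + L₃ y) * (L₄ x + L₄ y) +
    (L₁ y - L₁ x) * (L₂ y - L₂ x) * (L₃ y - L₃ x) * (L₄ y - L₄ x)) / 2 * hc

theorem integrable_prod_mul_add_mul {Ω : Type*} [MeasurableSpace Ω] {μ : Measure Ω} [SFinite μ]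
    {f g : Ω → 𝕜} (hf : Integrable f μ) (hg : Integrable g μ) :
    Integrable (fun z => f z.1 * g z.2 + g z.1 * f z.2) (μ.prod μ) :=
  (hf.mul_prod hg).add (hg.mul_prod hf)

theorem integral_prod_mul_add_mul {Ω : Type*} [MeasurableSpace Ω] {μ : Measure Ω} [SFinite μ]
    {f g : Ω → 𝕜} (hf : Integrable f μ) (hg : Integrable g μ) :
    ∫ z, f z.1 * g z.2 + g z.1 * f z.2 ∂μ.prod μ = 2 * ((∫ x, f x ∂μ) * ∫ x, g x ∂μ) := by
  rw [integral_add (hf.mul_prod hg) (hg.mul_prod hf), integral_prod_mul f g, integral_prod_mul g f]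
  ring

theorem integral_mul_mul_mul_eq_of_isGaussian (hμ : μ[id] = 0) (L₁ L₂ L₃ L₄ : E →L[ℝ] 𝕜) :
    ∫ x, (L₁ x * L₂ x) * (L₃ x * L₄ x) ∂μ =
      (∫ x, L₁ x * L₂ x ∂μ) * (∫ x, L₃ x * L₄ x ∂μ) +
      (∫ x, L₁ x * L₃ x ∂μ) * (∫ x, L₂ x * L₄ x ∂μ) +
      (∫ x, L₁ x * L₄ x ∂μ) * (∫ x, L₂ x * L₃ x ∂μ) := by
  have memLp_mul (L L' : E →L[ℝ] 𝕜) {r : ℝ≥0∞} (hr : r ≠ ∞) : MemLp (fun x => L x * L' x) r μ :=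
    memLp_bilinear_of_isGaussian (ContinuousLinearMap.mul ℝ 𝕜) L L' hr
  have integrable_mul (L L' : E →L[ℝ] 𝕜) : Integrable (fun x => L x * L' x) μ :=
    memLp_one_iff_integrable.mp (memLp_mul L L' ENNReal.one_ne_top)
  let M (x : E) : 𝕜 := (L₁ x * L₂ x) * (L₃ x * L₄ x)
  have hM : Integrable M μ := MemLp.integrable_mul (p := 2) (q := 2)
    (memLp_mul L₁ L₂ ENNReal.ofNat_ne_top) (memLp_mul L₃ L₄ ENNReal.ofNat_ne_top)
  let S (z : E × E) : 𝕜 := M z.1 + M z.2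
  have hS : Integrable S (μ.prod μ) := (hM.comp_fst μ).add (hM.comp_snd μ)
  have integral_S : ∫ z, S z ∂μ.prod μ = 2 * ∫ x, M x ∂μ := by
    rw [integral_add (hM.comp_fst μ) (hM.comp_snd μ), integral_fun_fst, integral_fun_snd]
    simp [two_mul]
  let T (L L' K K' : E →L[ℝ] 𝕜) (z : E × E) : 𝕜 :=
    (L z.1 * L' z.1) * (K z.2 * K' z.2) + (K z.1 * K' z.1) * (L z.2 * L' z.2)
  have hT (L L' K K' : E →L[ℝ] 𝕜) : Integrable (T L L' K K') (μ.prod μ) :=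
    integrable_prod_mul_add_mul (integrable_mul L L') (integrable_mul K K')
  have integral_T (L L' K K' : E →L[ℝ] 𝕜) : ∫ z, T L L' K K' z ∂μ.prod μ =
      2 * ((∫ x, L x * L' x ∂μ) * ∫ x, K x * K' x ∂μ) :=
    integral_prod_mul_add_mul (integrable_mul L L') (integrable_mul K K')
  have rotated : 2 * ∫ z, S z ∂μ.prod μ =
      ∫ z, S z + T L₁ L₂ L₃ L₄ z + T L₁ L₃ L₂ L₄ z + T L₁ L₄ L₂ L₃ z ∂μ.prod μ := by
    rw [← integral_comp_rotation_eq_of_isGaussian hμ (by fun_prop) (Real.pi / 4),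
      ← integral_const_mul]
    exact integral_congr_ae (.of_forall fun z => mul_rotation_pi_div_four L₁ L₂ L₃ L₄ rfl)
  rw [integral_S, integral_add (by fun_prop) (by fun_prop),
    integral_add (by fun_prop) (by fun_prop), integral_add hS (by fun_prop), integral_S,
    integral_T, integral_T, integral_T] at rotated
  linear_combination rotated / 2

end Wick

end Gaussian

section SeminormPower

variable {G : Type*} [NormedAddCommGroup G] [NormedSpace ℝ G] (F : Seminorm ℝ G) {p : ℝ}

theorem convexOn_seminorm_rpow (hp : 1 ≤ p) : ConvexOn ℝ Set.univ fun x => F x ^ p :=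
  ⟨convex_univ, fun x _ y _ _ _ ha hb hab =>
    (Real.rpow_le_rpow (apply_nonneg F _) (F.convexOn.2 trivial trivial ha hb hab)
      (zero_le_one.trans hp)).trans
        ((convexOn_rpow hp).2 (apply_nonneg F x) (apply_nonneg F y) ha hb hab)⟩

variable {Ω : Type*} [MeasurableSpace Ω] {μ : Measure Ω}

theorem integral_seminorm_add_swap_rpow_le [SFinite μ] (hp : 1 ≤ p) {X : Ω × Ω → G}
    (hX : Integrable (fun z => F (X z) ^ p) (μ.prod μ)) :
    ∫ z, F (X z + X z.swap) ^ p ∂μ.prod μ ≤ 2 ^ p * ∫ z, F (X z) ^ p ∂μ.prod μ := by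
  have hX' : Integrable (fun z => F (X z.swap) ^ p) (μ.prod μ) := hX.swap
  have pointwise (z : Ω × Ω) :
      F (X z + X z.swap) ^ p ≤ 2 ^ p * (2⁻¹ * (F (X z) ^ p + F (X z.swap) ^ p)) := by
    have hconvex := (convexOn_seminorm_rpow F hp).2 (Set.mem_univ (X z)) (Set.mem_univ (X z.swap))
      (by norm_num : (0 : ℝ) ≤ 2⁻¹) (by norm_num : (0 : ℝ) ≤ 2⁻¹) (by norm_num)
    have hsum : X z + X z.swap = (2 : ℝ) • ((2⁻¹ : ℝ) • X z + (2⁻¹ : ℝ) • X z.swap) := by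
      module
    rw [hsum, map_smul_eq_mul, Real.norm_ofNat, Real.mul_rpow zero_le_two (apply_nonneg F _),
      mul_add (2⁻¹ : ℝ)]
    exact mul_le_mul_of_nonneg_left hconvex (by positivity)
  calc ∫ z, F (X z + X z.swap) ^ p ∂μ.prod μ
      ≤ ∫ z, 2 ^ p * (2⁻¹ * (F (X z) ^ p + F (X z.swap) ^ p)) ∂μ.prod μ :=
        integral_mono_of_nonneg (.of_forall fun _ => by positivity)
          (((hX.add hX').const_mul _).const_mul _) (.of_forall pointwise)
    _ = 2 ^ p * ∫ z, F (X z) ^ p ∂μ.prod μ := by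
        rw [integral_const_mul, integral_const_mul, integral_add hX hX',
          integral_prod_swap fun z => F (X z) ^ p]
        ring

variable [FiniteDimensional ℝ G]

theorem continuous_seminorm_rpow (hp : 1 ≤ p) : Continuous fun x => F x ^ p :=
  (convexOn_seminorm_rpow F hp).locallyLipschitz.continuous

theorem integrable_seminorm_rpow (hp : 1 ≤ p) {X : Ω → G} (hX : MemLp X (ENNReal.ofReal p) μ) :
    Integrable (fun ω => F (X ω) ^ p) μ := by
  obtain ⟨C, hC, hF⟩ := F.bound_of_continuous_normedSpace F.convexOn.locallyLipschitz.continuous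
  have hp₀ : 0 < p := by positivity
  have hnorm : Integrable (fun ω => ‖X ω‖ ^ p) μ := by
    simpa [ENNReal.toReal_ofReal hp₀.le] using hX.integrable_norm_rpow (by simpa) (by simp)
  refine (hnorm.const_mul (C ^ p)).mono'
    ((continuous_seminorm_rpow F hp).comp_aestronglyMeasurable hX.1) (.of_forall fun ω => ?_)
  rw [Real.norm_of_nonneg (by positivity), ← Real.mul_rpow hC.le (norm_nonneg _)]
  gcongr
  exact hF _

theorem seminorm_integral_rpow_le [IsProbabilityMeasure μ] (hp : 1 ≤ p) {X : Ω → G}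
    (hX : Integrable X μ) (hFX : Integrable (fun ω => F (X ω) ^ p) μ) :
    F (∫ ω, X ω ∂μ) ^ p ≤ ∫ ω, F (X ω) ^ p ∂μ :=
  (convexOn_seminorm_rpow F hp).map_integral_le (continuous_seminorm_rpow F hp).continuousOn
    isClosed_univ (.of_forall fun _ => Set.mem_univ _) hX hFX

theorem integral_seminorm_rpow_integral_le [SFinite μ] {Ω' : Type*} [MeasurableSpace Ω']
    {ν : Measure Ω'} [IsProbabilityMeasure ν] (hp : 1 ≤ p) {X : Ω × Ω' → G}
    (hX : Integrable X (μ.prod ν)) (hFX : Integrable (fun z => F (X z) ^ p) (μ.prod ν)) :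
    ∫ ω, F (∫ ω', X (ω, ω') ∂ν) ^ p ∂μ ≤ ∫ z, F (X z) ^ p ∂μ.prod ν := by
  rw [integral_prod _ hFX]
  refine integral_mono_of_nonneg (.of_forall fun ω => by positivity) hFX.integral_prod_left ?_
  filter_upwards [hX.prod_right_ae, hFX.prod_right_ae] with ω hω hFω
  exact seminorm_integral_rpow_le F hp hω hFω

end SeminormPower

section Decoupling

variable {E G : Type*} [NormedAddCommGroup E] [NormedSpace ℝ E] [NormedAddCommGroup G]
  [NormedSpace ℝ G]

theorem bilinear_rotation_pi_div_four (B : E →L[ℝ] E →L[ℝ] G) (z : E × E) :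
    B (ContinuousLinearMap.rotation (Real.pi / 4) z).1
        (ContinuousLinearMap.rotation (Real.pi / 4) z).1 -
      B (ContinuousLinearMap.rotation (Real.pi / 4) z).2
        (ContinuousLinearMap.rotation (Real.pi / 4) z).2 = B z.1 z.2 + B z.2 z.1 := by
  have hc : 2 * (√2 / 2 * (√2 / 2)) = (1 : ℝ) := by
    linear_combination Real.mul_self_sqrt zero_le_two / 2
  simp only [ContinuousLinearMap.rotation_apply, Real.cos_pi_div_four, Real.sin_pi_div_four,
    map_add, map_smul, add_apply, smul_apply]
  linear_combination (norm := module) hc • (B z.1 z.2 + B z.2 z.1)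

variable [MeasurableSpace E] [BorelSpace E] [SecondCountableTopology E] [CompleteSpace E]
  {μ : Measure E} [IsGaussian μ] [FiniteDimensional ℝ G]

theorem integrable_seminorm_bilinear_rpow (B : E →L[ℝ] E →L[ℝ] G) (F : Seminorm ℝ G) {p : ℝ}
    (hp : 1 ≤ p) : Integrable (fun z => F (B z.1 z.2) ^ p) (μ.prod μ) :=
  integrable_seminorm_rpow F hp (memLp_bilinear_of_isGaussian B (.fst ℝ E E) (.snd ℝ E E)
    ENNReal.ofReal_ne_top)

theorem integral_seminorm_sub_integral_rpow_le (hμ : μ[id] = 0) (B : E →L[ℝ] E →L[ℝ] G)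
    (F : Seminorm ℝ G) {p : ℝ} (hp : 1 ≤ p) :
    ∫ x, F (B x x - ∫ y, B y y ∂μ) ^ p ∂μ ≤ 2 ^ p * ∫ z, F (B z.1 z.2) ^ p ∂μ.prod μ := by
  let fst := ContinuousLinearMap.fst ℝ E E
  let snd := ContinuousLinearMap.snd ℝ E E
  have memLp_diff {r : ℝ≥0∞} (hr : r ≠ ∞) :
      MemLp (fun z => B z.1 z.1 - B z.2 z.2) r (μ.prod μ) :=
    (memLp_bilinear_of_isGaussian B fst fst hr).sub (memLp_bilinear_of_isGaussian B snd snd hr)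
  have integral_sub (x : E) : B x x - ∫ y, B y y ∂μ = ∫ y, B x x - B y y ∂μ := by
    rw [integral_sub (integrable_const _), integral_const]
    · simp
    · exact memLp_one_iff_integrable.mp
        (memLp_bilinear_of_isGaussian B (.id ℝ E) (.id ℝ E) ENNReal.one_ne_top)
  calc ∫ x, F (B x x - ∫ y, B y y ∂μ) ^ p ∂μ
      = ∫ x, F (∫ y, B x x - B y y ∂μ) ^ p ∂μ := by simp only [integral_sub]
    _ ≤ ∫ z, F (B z.1 z.1 - B z.2 z.2) ^ p ∂μ.prod μ :=
      integral_seminorm_rpow_integral_le F hp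
        (memLp_one_iff_integrable.mp (memLp_diff ENNReal.one_ne_top))
        (integrable_seminorm_rpow F hp (memLp_diff ENNReal.ofReal_ne_top))
    _ = ∫ z, F (B z.1 z.2 + B z.2 z.1) ^ p ∂μ.prod μ := by
      rw [← integral_comp_rotation_eq_of_isGaussian hμ _ (Real.pi / 4)]
      · simp only [bilinear_rotation_pi_div_four B]
      · exact (continuous_seminorm_rpow F hp).comp (by fun_prop)
    _ ≤ 2 ^ p * ∫ z, F (B z.1 z.2) ^ p ∂μ.prod μ :=
      integral_seminorm_add_swap_rpow_le F hp (integrable_seminorm_bilinear_rpow B F hp)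

end Decoupling

open scoped Matrix.Norms.L2Operator

instance {m n : Type*} [Countable m] [Countable n] : SecondCountableTopology (Matrix m n ℂ) :=
  inferInstanceAs (SecondCountableTopology (m → n → ℂ))

section GaussianMatrix

theorem map_gaussianReal_prod_eq_stdGaussian :
    ((gaussianReal 0 1).prod (gaussianReal 0 1)).map
      (fun g : ℝ × ℝ => (g.1 : ℂ) + Complex.I * (g.2 : ℂ)) = stdGaussian ℂ := by
  rw [stdGaussian_eq_map_pi_orthonormalBasis Complex.orthonormalBasisOneI,
    ← (measurePreserving_piFinTwo fun _ : Fin 2 => gaussianReal 0 1).map_eq,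
    Measure.map_map (by fun_prop) (by fun_prop)]
  congr 1
  ext g
  simp [mul_comm]

theorem map_toLp_pi_stdGaussian (ι : Type*) [Fintype ι] :
    (Measure.pi fun _ : ι => stdGaussian ℂ).map (WithLp.toLp 2) =
      stdGaussian (PiLp 2 fun _ : ι => ℂ) := by
  refine Measure.ext_of_charFun (funext fun t => ?_)
  simp_rw [charFun_pi, charFun_stdGaussian, ← Complex.exp_sum, ← Complex.ofReal_pow,
    PiLp.norm_sq_eq_of_L2]
  simp [Finset.sum_div, neg_div]

variable {N : ℕ}

/-- Reshapes a vector of `N²` complex coordinates into a square matrix. -/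
def matrixOfVector (N : ℕ) :
    (PiLp 2 fun _ : Fin N × Fin N => ℂ) ≃ₗ[ℝ] Matrix (Fin N) (Fin N) ℂ :=
  (WithLp.linearEquiv 2 ℝ _).trans
    ((LinearEquiv.curry ℝ ℂ (Fin N) (Fin N)).trans (Matrix.ofLinearEquiv ℝ))

theorem matrixOfVector_apply (z : PiLp 2 fun _ : Fin N × Fin N => ℂ) (i j : Fin N) :
    matrixOfVector N z i j = z (i, j) := rfl

theorem sum_norm_sq_matrixOfVector (z : PiLp 2 fun _ : Fin N × Fin N => ℂ) :
    ∑ i, ∑ j, ‖matrixOfVector N z i j‖ ^ 2 = ‖z‖ ^ 2 := by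
  simp only [matrixOfVector_apply, PiLp.norm_sq_eq_of_L2, Fintype.sum_prod_type]

theorem gaussianMatrixLaw_eq_map_stdGaussian :
    gaussianMatrixLaw N = (stdGaussian (PiLp 2 fun _ : Fin N × Fin N => ℂ)).map
      ((√(2 * (N : ℝ)))⁻¹ • (matrixOfVector N).toLinearMap.toContinuousLinearMap) := by
  rw [← map_toLp_pi_stdGaussian, ← map_gaussianReal_prod_eq_stdGaussian,
    ← Measure.pi_map_pi fun _ => Measurable.aemeasurable (by fun_prop),
    Measure.map_map (by fun_prop) (by fun_prop), Measure.map_map (by fun_prop) (by fun_prop)]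
  rfl

instance : IsGaussian (gaussianMatrixLaw N) := by
  rw [gaussianMatrixLaw_eq_map_stdGaussian]
  infer_instance

theorem integral_id_gaussianMatrixLaw : (gaussianMatrixLaw N)[id] = 0 := by
  rw [gaussianMatrixLaw_eq_map_stdGaussian, integral_map (by fun_prop) (by fun_prop)]
  simp only [id]
  rw [ContinuousLinearMap.integral_comp_id_comm IsGaussian.integrable_id, integral_id_stdGaussian,
    map_zero]

theorem measurePreserving_gaussianMatrixLaw
    (A : Matrix (Fin N) (Fin N) ℂ →ₗ[ℝ] Matrix (Fin N) (Fin N) ℂ)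
    (hA : ∀ Y, ∑ i, ∑ j, ‖A Y i j‖ ^ 2 = ∑ i, ∑ j, ‖Y i j‖ ^ 2) :
    MeasurePreserving A (gaussianMatrixLaw N) (gaussianMatrixLaw N) := by
  let e := matrixOfVector N
  let f : (PiLp 2 fun _ : Fin N × Fin N => ℂ) →ₗᵢ[ℝ] (PiLp 2 fun _ : Fin N × Fin N => ℂ) :=
    { toLinearMap := e.symm.toLinearMap ∘ₗ A ∘ₗ e.toLinearMap
      norm_map' := fun z => by
        rw [← sq_eq_sq₀ (norm_nonneg _) (norm_nonneg _), ← sum_norm_sq_matrixOfVector,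
          ← sum_norm_sq_matrixOfVector, ← hA (matrixOfVector N z)]
        simp [e] }
  have hA_meas : Measurable A := (LinearMap.continuous_of_finiteDimensional A).measurable
  refine ⟨hA_meas, ?_⟩
  rw [gaussianMatrixLaw_eq_map_stdGaussian, Measure.map_map hA_meas (by fun_prop)]
  nth_rw 2 [← stdGaussian_map (f.toLinearIsometryEquiv rfl)]
  rw [Measure.map_map (by fun_prop) (by fun_prop)]
  congr 1
  ext1 z
  simp [f, e]

theorem sum_norm_sq_eq_trace {m : Type*} [Fintype m] (Y : Matrix m m ℂ) :
    ((∑ i, ∑ j, ‖Y i j‖ ^ 2 : ℝ) : ℂ) = (star Y * Y).trace := by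
  rw [Finset.sum_comm]
  simp [Matrix.trace, Matrix.mul_apply, Matrix.star_apply, Complex.conj_mul']

theorem measurePreserving_unitary_mul_mul_unitary {V W : Matrix (Fin N) (Fin N) ℂ}
    (hV : V ∈ Matrix.unitaryGroup (Fin N) ℂ) (hW : W ∈ Matrix.unitaryGroup (Fin N) ℂ) :
    MeasurePreserving (fun Y => V * Y * W) (gaussianMatrixLaw N) (gaussianMatrixLaw N) := by
  refine measurePreserving_gaussianMatrixLaw
    (LinearMap.mulRight ℝ W ∘ₗ LinearMap.mulLeft ℝ V) fun Y => ?_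
  have h : (star (V * Y * W) * (V * Y * W)).trace = (star Y * Y).trace := by
    calc (star (V * Y * W) * (V * Y * W)).trace
        = (star W * (star Y * (star V * V) * Y * W)).trace := by simp only [star_mul, mul_assoc]
      _ = (star Y * Y * (W * star W)).trace := by
        rw [Matrix.mem_unitaryGroup_iff'.mp hV, mul_one, Matrix.trace_mul_comm, mul_assoc]
      _ = (star Y * Y).trace := by rw [Matrix.mem_unitaryGroup_iff.mp hW, mul_one]
  exact_mod_cast (sum_norm_sq_eq_trace (V * Y * W)).trans (h.trans (sum_norm_sq_eq_trace Y).symm)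

theorem measurePreserving_phases {θ : Matrix (Fin N) (Fin N) ℂ} (hθ : ∀ i j, ‖θ i j‖ = 1) :
    MeasurePreserving (Matrix.hadamard θ) (gaussianMatrixLaw N) (gaussianMatrixLaw N) :=
  measurePreserving_gaussianMatrixLaw
    { toFun := Matrix.hadamard θ
      map_add' := fun Y Z => Matrix.hadamard_add θ Y Z
      map_smul' := fun c Y => Matrix.hadamard_smul θ Y c } fun Y => by simp [hθ]

theorem integral_eq_zero_of_phases {θ : Matrix (Fin N) (Fin N) ℂ} (hθ : ∀ i j, ‖θ i j‖ = 1)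
    {f : Matrix (Fin N) (Fin N) ℂ → ℂ} (hf : Continuous f)
    (hfθ : ∀ Y, f (θ.hadamard Y) = -f Y) : ∫ Y, f Y ∂gaussianMatrixLaw N = 0 := by
  have h := measurePreserving_phases hθ
  refine self_eq_neg.mp ?_
  rw [← integral_neg]
  nth_rw 1 [← h.map_eq]
  simp only [integral_map h.aemeasurable hf.aestronglyMeasurable, hfθ]

theorem continuous_entry (i j : Fin N) : Continuous fun Y : Matrix (Fin N) (Fin N) ℂ => Y i j :=
  continuous_id.matrix_elem i j

theorem integral_entry_mul_entry (a b c d : Fin N) :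
    ∫ Y, Y a b * Y c d ∂gaussianMatrixLaw N = 0 :=
  integral_eq_zero_of_phases (θ := Matrix.of fun _ _ => Complex.I) (by simp)
    ((continuous_entry a b).mul (continuous_entry c d)) fun Y => by
      simp only [Matrix.hadamard_apply, Matrix.of_apply]
      linear_combination (Y a b * Y c d) * Complex.I_mul_I

theorem integral_sq_gaussianReal : ∫ x, x ^ 2 ∂gaussianReal 0 1 = 1 := by
  simpa using (variance_eq_sub (memLp_id_gaussianReal (μ := 0) (v := 1) 2)).symm

theorem integral_norm_sq_entry (a b : Fin N) :
    ∫ Y, ‖Y a b‖ ^ 2 ∂gaussianMatrixLaw N = (N : ℝ)⁻¹ := by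
  have hN : 0 < (N : ℝ) := by exact_mod_cast a.pos
  have continuous_norm_sq_entry : Continuous fun Y : Matrix (Fin N) (Fin N) ℂ => ‖Y a b‖ ^ 2 :=
    (continuous_entry a b).norm.pow 2
  have integrable_sq : Integrable (fun x : ℝ => x ^ 2) (gaussianReal 0 1) :=
    (memLp_id_gaussianReal 2).integrable_sq
  let f (g : ℝ × ℝ) : ℝ := (2 * (N : ℝ))⁻¹ * (g.1 ^ 2 + g.2 ^ 2)
  have norm_sq_entry (g : Fin N × Fin N → ℝ × ℝ) :
      ‖(((√(2 * (N : ℝ)))⁻¹ : ℝ) : ℂ) * (((g (a, b)).1 : ℂ) + Complex.I * ((g (a, b)).2 : ℂ))‖ ^ 2 =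
        f (g (a, b)) := by
    rw [norm_mul, mul_pow, Complex.norm_real, Real.norm_eq_abs, sq_abs, inv_pow,
      Real.sq_sqrt (by positivity), ← Complex.normSq_eq_norm_sq, mul_comm Complex.I,
      Complex.normSq_add_mul_I]
  rw [gaussianMatrixLaw, integral_map (Measurable.aemeasurable (by fun_prop))
    continuous_norm_sq_entry.aestronglyMeasurable]
  simp only [Matrix.of_apply, norm_sq_entry]
  rw [integral_comp_eval (μ := fun _ : Fin N × Fin N => (gaussianReal 0 1).prod (gaussianReal 0 1))
      (i := (a, b)) (f := f) (Continuous.aestronglyMeasurable (by fun_prop)), integral_const_mul,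
    integral_add (integrable_sq.comp_fst _) (integrable_sq.comp_snd _),
    integral_fun_fst fun x : ℝ => x ^ 2, integral_fun_snd fun x : ℝ => x ^ 2,
    integral_sq_gaussianReal]
  simp only [probReal_univ, one_smul]
  field_simp
  norm_num

theorem integral_entry_mul_star_entry (a b c d : Fin N) :
    ∫ Y, Y a b * star (Y c d) ∂gaussianMatrixLaw N =
      if a = c ∧ b = d then (N : ℂ)⁻¹ else 0 := by
  split_ifs with h
  · obtain ⟨rfl, rfl⟩ := h
    simp only [RCLike.star_def, Complex.mul_conj', ← Complex.ofReal_pow, integral_complex_ofReal,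
      integral_norm_sq_entry, Complex.ofReal_inv, Complex.ofReal_natCast]
  · refine integral_eq_zero_of_phases
      (θ := Matrix.of fun i j => if i = a ∧ j = b then -1 else 1) (fun i j => ?_)
      ((continuous_entry a b).mul (continuous_entry c d).star) fun Y => ?_
    · rw [Matrix.of_apply]
      split_ifs <;> simp
    · have h' : ¬ (c = a ∧ d = b) := fun hc => h ⟨hc.1.symm, hc.2.symm⟩
      simp [h']

end GaussianMatrix

section Moments

variable {N : ℕ}

/-- The entry `Y ↦ Y i j`, as a real-linear functional. -/
def entryCLM (i j : Fin N) : Matrix (Fin N) (Fin N) ℂ →L[ℝ] ℂ :=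
  (Matrix.entryLinearMap ℝ ℂ i j).toContinuousLinearMap

/-- The conjugate entry `Y ↦ star (Y i j)`, as a real-linear functional. -/
def starEntryCLM (i j : Fin N) : Matrix (Fin N) (Fin N) ℂ →L[ℝ] ℂ :=
  (Complex.conjCLE : ℂ →L[ℝ] ℂ) ∘L entryCLM i j

theorem entryCLM_apply (i j : Fin N) (Y) : entryCLM i j Y = Y i j := rfl

theorem starEntryCLM_apply (i j : Fin N) (Y) : starEntryCLM i j Y = star (Y i j) := rfl

theorem memLp_star_entry_mul_entry (a b c d : Fin N) {r : ℝ≥0∞} (hr : r ≠ ∞) :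
    MemLp (fun Y => star (Y a b) * Y c d) r (gaussianMatrixLaw N) :=
  memLp_bilinear_of_isGaussian (ContinuousLinearMap.mul ℝ ℂ) (starEntryCLM a b) (entryCLM c d) hr

theorem integral_star_entry_mul_entry (a b c d : Fin N) :
    ∫ Y, star (Y a b) * Y c d ∂gaussianMatrixLaw N = if a = c ∧ b = d then (N : ℂ)⁻¹ else 0 := by
  simp only [mul_comm (star _), integral_entry_mul_star_entry, eq_comm]

theorem integral_star_entry_mul_star_entry (a b c d : Fin N) :
    ∫ Y, star (Y a b) * star (Y c d) ∂gaussianMatrixLaw N = 0 := by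
  simp only [RCLike.star_def, ← map_mul]
  rw [integral_conj, integral_entry_mul_entry, map_zero]

theorem integral_four_entries (i j k l : Fin N) :
    ∫ Y, (star (Y k i) * Y k j) * (star (Y l j) * Y l i) ∂gaussianMatrixLaw N =
      (N : ℂ)⁻¹ ^ 2 * ((if i = j then 1 else 0) + if k = l then 1 else 0) := by
  have wick := integral_mul_mul_mul_eq_of_isGaussian (integral_id_gaussianMatrixLaw (N := N))
    (starEntryCLM k i) (entryCLM k j) (starEntryCLM l j) (entryCLM l i)
  simp only [entryCLM_apply, starEntryCLM_apply, integral_star_entry_mul_entry,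
    integral_star_entry_mul_star_entry, integral_entry_mul_star_entry] at wick
  rw [wick]
  rcases eq_or_ne i j with rfl | hij <;> rcases eq_or_ne k l with rfl | hkl <;>
    simp [*, Ne.symm, sq, mul_add]

theorem integrable_star_entry_mul_entry (a b c d : Fin N) :
    Integrable (fun Y => star (Y a b) * Y c d) (gaussianMatrixLaw N) :=
  memLp_one_iff_integrable.mp (memLp_star_entry_mul_entry a b c d ENNReal.one_ne_top)

theorem trace_star_mul_self (Y : Matrix (Fin N) (Fin N) ℂ) :
    (star Y * Y).trace = ∑ i, ∑ k, star (Y k i) * Y k i := by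
  simp only [Matrix.trace, Matrix.diag_apply, Matrix.mul_apply, Matrix.star_apply]

theorem integrable_trace_star_mul_self :
    Integrable (fun Y => (star Y * Y).trace) (gaussianMatrixLaw N) := by
  simp only [trace_star_mul_self]
  exact integrable_finsetSum _ fun i _ => integrable_finsetSum _ fun k _ =>
    integrable_star_entry_mul_entry k i k i

theorem integral_trace_star_mul_self :
    ∫ Y, (star Y * Y).trace ∂gaussianMatrixLaw N = N := by
  simp only [trace_star_mul_self]
  rw [integral_finsetSum _ fun i _ => integrable_finsetSum _ fun k _ =>
    integrable_star_entry_mul_entry k i k i]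
  simp_rw [integral_finsetSum _ fun k _ => integrable_star_entry_mul_entry k _ k _,
    integral_star_entry_mul_entry]
  rcases eq_or_ne (N : ℂ) 0 with hN | hN <;> simp [hN]

theorem integrable_four_entries (i j k l : Fin N) :
    Integrable (fun Y => (star (Y k i) * Y k j) * (star (Y l j) * Y l i)) (gaussianMatrixLaw N) :=
  MemLp.integrable_mul (p := 2) (q := 2) (memLp_star_entry_mul_entry k i k j ENNReal.ofNat_ne_top)
    (memLp_star_entry_mul_entry l j l i ENNReal.ofNat_ne_top)

theorem trace_star_mul_self_mul_star_mul_self (Y : Matrix (Fin N) (Fin N) ℂ) :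
    ((star Y * Y) * (star Y * Y)).trace =
      ∑ i, ∑ j, ∑ k, ∑ l, (star (Y k i) * Y k j) * (star (Y l j) * Y l i) := by
  simp only [Matrix.trace, Matrix.diag_apply, Matrix.mul_apply (M := star Y * Y),
    Matrix.mul_apply (M := star Y), Matrix.star_apply, Finset.sum_mul_sum]

theorem integrable_trace_star_mul_self_sq :
    Integrable (fun Y => ((star Y * Y) * (star Y * Y)).trace) (gaussianMatrixLaw N) := by
  simp only [trace_star_mul_self_mul_star_mul_self]
  exact integrable_finsetSum _ fun i _ => integrable_finsetSum _ fun j _ => integrable_finsetSum _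
    fun k _ => integrable_finsetSum _ fun l _ => integrable_four_entries i j k l

theorem integral_trace_star_mul_self_sq :
    ∫ Y, ((star Y * Y) * (star Y * Y)).trace ∂gaussianMatrixLaw N = 2 * N := by
  simp only [trace_star_mul_self_mul_star_mul_self]
  rw [integral_finsetSum _ fun i _ => integrable_finsetSum _ fun j _ => integrable_finsetSum _
    fun k _ => integrable_finsetSum _ fun l _ => integrable_four_entries i j k l]
  simp_rw [integral_finsetSum _ fun j _ => integrable_finsetSum _
    fun k _ => integrable_finsetSum _ fun l _ => integrable_four_entries _ j k l,
    integral_finsetSum _ fun k _ => integrable_finsetSum _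
      fun l _ => integrable_four_entries _ _ k l,
    integral_finsetSum _ fun l _ => integrable_four_entries _ _ _ l, integral_four_entries]
  simp only [← Finset.mul_sum, Finset.sum_add_distrib, Finset.sum_ite_eq, Finset.mem_univ, if_true,
    Finset.sum_const, Finset.card_univ, Fintype.card_fin, nsmul_eq_mul]
  rcases eq_or_ne (N : ℂ) 0 with hN | hN
  · simp [hN]
  · field_simp
    norm_num

end Moments

section TensorConjBilin

variable {N : ℕ}

/-- `(x, y) ↦ x ⊗ ȳ`, which is bilinear over the reals only. -/
def tensorConjBilin (N : ℕ) : Matrix (Fin N) (Fin N) ℂ →L[ℝ] Matrix (Fin N) (Fin N) ℂ →L[ℝ]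
    Matrix (Fin N × Fin N) (Fin N × Fin N) ℂ :=
  LinearMap.toContinuousBilinearMap <| LinearMap.mk₂ ℝ tensorConj
    (fun x x' y => by ext; simp [tensorConj_apply, add_mul])
    (fun c x y => by ext; simp [tensorConj_apply, mul_assoc])
    (fun x y y' => by ext; simp [tensorConj_apply, mul_add])
    (fun c x y => by ext; simp [tensorConj_apply, mul_left_comm])

theorem integrable_tensorConj_self :
    Integrable (fun Y => tensorConj Y Y) (gaussianMatrixLaw N) :=
  memLp_one_iff_integrable.mp
    (memLp_bilinear_of_isGaussian (tensorConjBilin N) (.id ℝ _) (.id ℝ _) ENNReal.one_ne_top)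

theorem integral_tensorConj_self : ∫ Y, tensorConj Y Y ∂gaussianMatrixLaw N = projId N := by
  ext r s
  have h := (Matrix.entryLinearMap ℝ ℂ r s).toContinuousLinearMap.integral_comp_comm
    (integrable_tensorConj_self (N := N))
  refine h.symm.trans ?_
  simp only [LinearMap.coe_toContinuousLinearMap', Matrix.entryLinearMap_apply, tensorConj_apply,
    integral_entry_mul_star_entry]
  by_cases hr : r.1 = r.2 <;> by_cases hs : s.1 = s.2 <;>
    simp [projId, idVec, Matrix.vecMulVec_apply, Matrix.one_apply, hr, hs]

end TensorConjBilin

section Haar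

variable {N : ℕ}

instance : (haarUnitary N).IsHaarMeasure := by
  unfold haarUnitary
  infer_instance

instance : IsProbabilityMeasure (haarUnitary N) := ⟨Measure.haarMeasure_self⟩

instance : SecondCountableTopology (Matrix.unitaryGroup (Fin N) ℂ) :=
  inferInstanceAs (SecondCountableTopology
    ((Matrix.unitaryGroup (Fin N) ℂ : Set (Matrix (Fin N) (Fin N) ℂ))))

theorem measurePreserving_mul_right_haarUnitary (g : Matrix.unitaryGroup (Fin N) ℂ) :
    MeasurePreserving (fun U => U * g) (haarUnitary N) (haarUnitary N) := by
  have hg : Measurable fun U : Matrix.unitaryGroup (Fin N) ℂ => U * g :=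
    (continuous_mul_const g).measurable
  have : IsProbabilityMeasure ((haarUnitary N).map fun U => U * g) :=
    Measure.isProbabilityMeasure_map hg.aemeasurable
  exact ⟨hg, Measure.isHaarMeasure_eq_of_isProbabilityMeasure _ _⟩

open scoped MatrixOrder

theorem continuous_unitary_mul {f : Matrix (Fin N) (Fin N) ℂ → Matrix (Fin N) (Fin N) ℂ}
    (hf : Continuous f) :
    Continuous fun z : Matrix.unitaryGroup (Fin N) ℂ × Matrix (Fin N) (Fin N) ℂ => z.1.1 * f z.2 :=
  (continuous_subtype_val.comp continuous_fst).matrix_mul (hf.comp continuous_snd)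

theorem lintegral_unitary_mul_abs {f : Matrix (Fin N) (Fin N) ℂ → ℝ≥0∞} (hf : Measurable f)
    (Y : Matrix (Fin N) (Fin N) ℂ) :
    ∫⁻ U, f (U.1 * CFC.abs Y) ∂haarUnitary N = ∫⁻ U, f (U.1 * Y) ∂haarUnitary N := by
  obtain ⟨w, hw, hY⟩ := exists_unitary_mul_abs Y
  have h := (measurePreserving_mul_right_haarUnitary ⟨w, hw⟩).lintegral_comp
    (hf.comp (measurable_subtype_coe.mul_const (CFC.abs Y)))
  simpa only [Function.comp_apply, Submonoid.coe_mul, mul_assoc, ← hY] using h.symm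

/-- By the polar decomposition `Y = w|Y|` with `w` unitary, and `U ↦ Uw` preserves the Haar measure
for every fixed `Y`, so that `U|Y|` has the law of `UY`. -/
theorem measurePreserving_unitary_mul_abs :
    MeasurePreserving (fun z : Matrix.unitaryGroup (Fin N) ℂ × Matrix (Fin N) (Fin N) ℂ =>
      z.1.1 * CFC.abs z.2) ((haarUnitary N).prod (gaussianMatrixLaw N)) (gaussianMatrixLaw N) := by
  have measurable_mul_abs := (continuous_unitary_mul (N := N) CFC.continuous_abs).measurable
  have measurable_mul := (continuous_unitary_mul (N := N) continuous_id).measurable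
  refine ⟨measurable_mul_abs, Measure.ext_of_lintegral _ fun f hf => ?_⟩
  calc ∫⁻ Y, f Y ∂((haarUnitary N).prod (gaussianMatrixLaw N)).map _
      = ∫⁻ Y, ∫⁻ U, f (U.1 * CFC.abs Y) ∂haarUnitary N ∂gaussianMatrixLaw N := by
        rw [lintegral_map hf measurable_mul_abs]
        exact lintegral_prod_symm _ (hf.comp measurable_mul_abs).aemeasurable
    _ = ∫⁻ Y, ∫⁻ U, f (U.1 * Y) ∂haarUnitary N ∂gaussianMatrixLaw N := by
        simp only [lintegral_unitary_mul_abs hf]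
    _ = ∫⁻ U, ∫⁻ Y, f (U.1 * Y) ∂gaussianMatrixLaw N ∂haarUnitary N :=
        (lintegral_lintegral_swap (f := fun (U : Matrix.unitaryGroup (Fin N) ℂ) Y => f (U.1 * Y))
          (hf.comp measurable_mul).aemeasurable).symm
    _ = ∫⁻ _U, ∫⁻ Y, f Y ∂gaussianMatrixLaw N ∂haarUnitary N := by
        refine lintegral_congr fun U => ?_
        have h := (measurePreserving_unitary_mul_mul_unitary U.2 (one_mem _)).lintegral_comp hf
        simpa only [mul_one] using h
    _ = ∫⁻ Y, f Y ∂gaussianMatrixLaw N := by rw [lintegral_const, measure_univ, mul_one]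

theorem abs_unitary_mul_mul_star {m : Type*} [Fintype m] [DecidableEq m] {V : Matrix m m ℂ}
    (hV : V ∈ Matrix.unitaryGroup m ℂ) (Y : Matrix m m ℂ) :
    CFC.abs (V * Y * star V) = V * CFC.abs Y * star V := by
  have hV' := Matrix.mem_unitaryGroup_iff'.mp hV
  refine CFC.sqrt_unique ?_ (star_right_conjugate_nonneg (CFC.abs_nonneg Y) V)
  calc V * CFC.abs Y * star V * (V * CFC.abs Y * star V)
      = V * CFC.abs Y * (star V * V) * CFC.abs Y * star V := by simp only [mul_assoc]
    _ = V * (CFC.abs Y * CFC.abs Y) * star V := by rw [hV']; simp only [mul_assoc, mul_one]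
    _ = V * (star Y * (star V * V) * Y) * star V := by rw [hV', CFC.abs_mul_abs, mul_one]
    _ = star (V * Y * star V) * (V * Y * star V) := by simp only [star_mul, star_star, mul_assoc]

end Haar

open scoped MatrixOrder

section MeanAbs

variable {N : ℕ}

theorem memLp_abs {r : ℝ≥0∞} (hr : r ≠ ∞) : MemLp CFC.abs r (gaussianMatrixLaw N) :=
  (memLp_congr_norm CFC.continuous_abs.aestronglyMeasurable aestronglyMeasurable_id
    (.of_forall fun _ => CFC.norm_abs)).mpr (IsGaussian.memLp_id _ r hr)

theorem integrable_tensorConj_abs :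
    Integrable (fun Y => tensorConj (CFC.abs Y) (CFC.abs Y)) (gaussianMatrixLaw N) :=
  memLp_one_iff_integrable.mp <| (tensorConjBilin N).memLp_of_bilin 1
    (p := 2) (q := 2) (memLp_abs ENNReal.ofNat_ne_top) (memLp_abs ENNReal.ofNat_ne_top)

/-- The mean of `|Y| ⊗ |Y|‾` for a Gaussian matrix `Y`. -/
def meanAbs (N : ℕ) : Matrix (Fin N × Fin N) (Fin N × Fin N) ℂ :=
  ∫ Y, tensorConj (CFC.abs Y) (CFC.abs Y) ∂gaussianMatrixLaw N

theorem commute_tensorConj_meanAbs {V : Matrix (Fin N) (Fin N) ℂ}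
    (hV : V ∈ Matrix.unitaryGroup (Fin N) ℂ) : Commute (tensorConj V V) (meanAbs N) := by
  have hV' : star V ∈ Matrix.unitaryGroup (Fin N) ℂ := Unitary.star_mem hV
  have meanAbs_eq : meanAbs N = tensorConj V V * meanAbs N * tensorConj (star V) (star V) := by
    calc meanAbs N
        = ∫ Y, tensorConj (CFC.abs (V * Y * star V)) (CFC.abs (V * Y * star V))
            ∂gaussianMatrixLaw N := by
          have h := measurePreserving_unitary_mul_mul_unitary hV hV'
          conv_lhs => rw [meanAbs, ← h.map_eq]
          refine integral_map h.aemeasurable ?_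
          rw [h.map_eq]
          exact integrable_tensorConj_abs.aestronglyMeasurable
      _ = ∫ Y, tensorConj V V * tensorConj (CFC.abs Y) (CFC.abs Y) *
            tensorConj (star V) (star V) ∂gaussianMatrixLaw N := by
          simp only [abs_unitary_mul_mul_star hV, tensorConj_mul_tensorConj]
      _ = tensorConj V V * meanAbs N * tensorConj (star V) (star V) := by
          rw [integral_mul_const_of_integrable (integrable_tensorConj_abs.const_mul _),
            integral_const_mul_of_integrable integrable_tensorConj_abs, meanAbs]
  have h : meanAbs N * tensorConj V V = tensorConj V V * meanAbs N := by
    nth_rw 1 [meanAbs_eq]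
    rw [mul_assoc, tensorConj_mul_tensorConj, Matrix.mem_unitaryGroup_iff'.mp hV, tensorConj_one,
      mul_one]
  exact h.symm

theorem trace_meanAbs_mul (T : Matrix (Fin N × Fin N) (Fin N × Fin N) ℂ) :
    (meanAbs N * T).trace =
      ∫ Y, (tensorConj (CFC.abs Y) (CFC.abs Y) * T).trace ∂gaussianMatrixLaw N :=
  (ContinuousLinearMap.integral_comp_comm (LinearMap.toContinuousLinearMap
    (Matrix.traceLinearMap _ ℝ ℂ ∘ₗ LinearMap.mulRight ℝ T)) integrable_tensorConj_abs).symm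

theorem trace_meanAbs :
    (meanAbs N).trace = ((∫ Y, ‖(CFC.abs Y).trace‖ ^ 2 ∂gaussianMatrixLaw N : ℝ) : ℂ) := by
  have h := trace_meanAbs_mul (N := N) 1
  simp only [mul_one, trace_tensorConj, RCLike.star_def, Complex.mul_conj'] at h
  rw [h, ← integral_complex_ofReal]
  simp only [Complex.ofReal_pow]

theorem trace_meanAbs_mul_projId [NeZero N] : (meanAbs N * projId N).trace = 1 := by
  have star_abs (Y : Matrix (Fin N) (Fin N) ℂ) : star (CFC.abs Y) = CFC.abs Y :=
    (CFC.abs_nonneg Y).isSelfAdjoint.star_eq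
  simp only [trace_meanAbs_mul, trace_tensorConj_mul_projId, star_abs, CFC.abs_mul_abs]
  rw [integral_const_mul, integral_trace_star_mul_self, inv_mul_cancel₀ (NeZero.ne _)]

end MeanAbs

section TraceAbs

theorem sub_le_trace_abs {m : Type*} [Fintype m] [DecidableEq m] (Y : Matrix m m ℂ) :
    (star Y * Y).trace.re - 4 / 27 * ((star Y * Y) * (star Y * Y)).trace.re ≤
      (CFC.abs Y).trace.re := by
  obtain ⟨-, -, -, -, s, hs, -, trace_cfc⟩ := exists_singular_value_decomposition Y
  have trace_pow (k : ℕ) : (CFC.abs Y ^ k).trace.re = ∑ i, s i ^ k := by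
    have h := trace_cfc (fun t => t ^ k)
    rw [cfc_pow_id (CFC.abs Y) k] at h
    rw [h, ← Complex.ofReal_sum, Complex.ofReal_re]
  have key (t : ℝ) (ht : 0 ≤ t) : t ^ 2 - 4 / 27 * t ^ 4 ≤ t := by
    have : 0 ≤ 4 / 27 * (t * (t + 3) * (t - 3 / 2) ^ 2) := by positivity
    linarith
  rw [← CFC.abs_mul_abs]
  calc _ = ∑ i, (s i ^ 2 - 4 / 27 * s i ^ 4) := by
        rw [Finset.sum_sub_distrib, ← Finset.mul_sum, ← trace_pow, ← trace_pow]
        simp only [pow_succ, pow_zero, one_mul, mul_assoc]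
    _ ≤ ∑ i, s i := Finset.sum_le_sum fun i _ => key (s i) (hs i)
    _ = (CFC.abs Y).trace.re := by simpa using (trace_pow 1).symm

variable (N : ℕ)

theorem integrable_norm_trace_abs_sq :
    Integrable (fun Y => ‖(CFC.abs Y).trace‖ ^ 2) (gaussianMatrixLaw N) := by
  have h := ((LinearMap.toContinuousLinearMap
    (Matrix.traceLinearMap (Fin N × Fin N) ℝ ℂ)).integrable_comp integrable_tensorConj_abs).norm
  simpa [trace_tensorConj, ← sq] using h

/-- Cauchy–Schwarz, as `2 a t - a ^ 2 ≤ t ^ 2` at the value `a` of the lower bound. -/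
theorem le_integral_norm_trace_abs_sq :
    (19 / 27 * N : ℝ) ^ 2 ≤ ∫ Y, ‖(CFC.abs Y).trace‖ ^ 2 ∂gaussianMatrixLaw N := by
  let a : ℝ := 19 / 27 * N
  have ha : 0 ≤ a := by positivity
  let f (Y : Matrix (Fin N) (Fin N) ℂ) : ℝ :=
    (star Y * Y).trace.re - 4 / 27 * ((star Y * Y) * (star Y * Y)).trace.re
  have hf : Integrable f (gaussianMatrixLaw N) :=
    integrable_trace_star_mul_self.re.sub (integrable_trace_star_mul_self_sq.re.const_mul _)
  have integral_f : ∫ Y, f Y ∂gaussianMatrixLaw N = a := by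
    have h₂ := integral_re (integrable_trace_star_mul_self (N := N))
    have h₄ := integral_re (integrable_trace_star_mul_self_sq (N := N))
    rw [integral_trace_star_mul_self] at h₂
    rw [integral_trace_star_mul_self_sq] at h₄
    refine (integral_sub integrable_trace_star_mul_self.re
      (integrable_trace_star_mul_self_sq.re.const_mul _)).trans ?_
    rw [integral_const_mul, h₂, h₄]
    simp only [RCLike.re_to_complex, Complex.natCast_re, Complex.mul_re, Complex.re_ofNat,
      Complex.im_ofNat, zero_mul, sub_zero, a]
    ring
  have pointwise (Y : Matrix (Fin N) (Fin N) ℂ) :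
      2 * a * f Y - a ^ 2 ≤ ‖(CFC.abs Y).trace‖ ^ 2 := by
    have h : f Y ≤ ‖(CFC.abs Y).trace‖ :=
      (sub_le_trace_abs Y).trans (Complex.re_le_norm _)
    linarith [two_mul_le_add_sq a ‖(CFC.abs Y).trace‖,
      mul_le_mul_of_nonneg_left h (mul_nonneg zero_le_two ha)]
  calc a ^ 2 = ∫ Y, 2 * a * f Y - a ^ 2 ∂gaussianMatrixLaw N := by
        rw [integral_sub (hf.const_mul _) (integrable_const _), integral_const_mul, integral_f]
        simp only [integral_const, probReal_univ, one_smul]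
        ring
    _ ≤ ∫ Y, ‖(CFC.abs Y).trace‖ ^ 2 ∂gaussianMatrixLaw N :=
        integral_mono ((hf.const_mul _).sub (integrable_const _)) (integrable_norm_trace_abs_sq N)
          pointwise

theorem projId_eq_one_of_subsingleton {N : ℕ} [Subsingleton (Fin N)] : projId N = 1 := by
  ext r s
  have hN : N = 1 := le_antisymm (Fin.subsingleton_iff_le_one.mp inferInstance) r.1.pos
  subst hN
  simp [projId, idVec, Matrix.vecMulVec_apply, Matrix.one_apply, Subsingleton.elim r s,
    Subsingleton.elim s.1 s.2]

theorem exists_meanAbs_mul_one_sub_projId_eq :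
    ∃ c : ℝ, 1 / 4 ≤ c ∧ meanAbs N * (1 - projId N) = c • (1 - projId N) := by
  obtain ⟨c, hc⟩ := exists_mul_one_sub_projId_eq fun V hV => commute_tensorConj_meanAbs (N := N) hV
  rcases lt_or_ge N 2 with hN | hN
  · have : Subsingleton (Fin N) := Fin.subsingleton_iff_le_one.mpr (by omega)
    refine ⟨1 / 4, le_rfl, ?_⟩
    rw [projId_eq_one_of_subsingleton, sub_self, mul_zero, smul_zero]
  have : NeZero N := ⟨by omega⟩
  let I := ∫ Y, ‖(CFC.abs Y).trace‖ ^ 2 ∂gaussianMatrixLaw N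
  have hN' : (0 : ℝ) < N ^ 2 - 1 := by
    have : (2 : ℝ) ≤ N := by exact_mod_cast hN
    nlinarith
  have trace_eq : (I : ℂ) - 1 = c * (N ^ 2 - 1) := by
    have h := congrArg Matrix.trace hc
    rw [mul_sub, mul_one, Matrix.trace_sub, trace_meanAbs, trace_meanAbs_mul_projId,
      Matrix.trace_smul, Matrix.trace_sub, trace_projId, Matrix.trace_one] at h
    simpa [pow_two (N : ℂ)] using h
  refine ⟨(I - 1) / (N ^ 2 - 1), ?_, ?_⟩
  · rw [le_div_iff₀ hN']
    have := le_integral_norm_trace_abs_sq N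
    have : (2 : ℝ) ≤ N := by exact_mod_cast hN
    nlinarith
  · have hc' : c = (((I - 1) / (N ^ 2 - 1) : ℝ) : ℂ) := by
      have hN'' : (N ^ 2 - 1 : ℂ) ≠ 0 := by exact_mod_cast hN'.ne'
      rw [eq_comm]
      push_cast
      rw [div_eq_iff hN'', trace_eq]
    rw [hc, hc', Complex.coe_smul]

end TraceAbs

section ProductLaw

variable {ι E G : Type*} [Fintype ι] [MeasurableSpace E] {μ : Measure E} [IsProbabilityMeasure μ]
  [NormedAddCommGroup G] {f : E → G}

theorem integrable_pi_comp (hf : Integrable f μ) :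
    Integrable (fun (x : ι → E) i => f (x i)) (Measure.pi fun _ : ι => μ) :=
  Integrable.of_eval fun i => integrable_comp_eval (μ := fun _ : ι => μ) (i := i) hf

theorem integral_pi_comp [NormedSpace ℝ G] [CompleteSpace G] (hf : Integrable f μ) :
    ∫ x, (fun i => f (x i)) ∂(Measure.pi fun _ : ι => μ) = fun _ => ∫ y, f y ∂μ := by
  ext i
  rw [eval_integral fun _ => integrable_comp_eval hf]
  exact integral_comp_eval (μ := fun _ : ι => μ) (i := i) hf.aestronglyMeasurable

instance isGaussian_pi {E : Type*} [NormedAddCommGroup E] [NormedSpace ℝ E] [MeasurableSpace E]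
    [BorelSpace E] [SecondCountableTopology E] [CompleteSpace E] {μ : Measure E} [IsGaussian μ] :
    IsGaussian (Measure.pi fun _ : ι => μ) := by
  have hasGaussianLaw_eval (i : ι) :
      HasGaussianLaw (fun x : ι → E => x i) (Measure.pi fun _ : ι => μ) := by
    refine ⟨?_⟩
    rw [(measurePreserving_eval (fun _ : ι => μ) i).map_eq]
    infer_instance
  have h := (iIndepFun.hasGaussianLaw hasGaussianLaw_eval
    (iIndepFun_pi (μ := fun _ : ι => μ) fun _ => aemeasurable_id)).isGaussian_map
  exact Measure.map_id (μ := Measure.pi fun _ : ι => μ) ▸ h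

end ProductLaw

section Comparison

variable {ι : Type*} [Fintype ι] {N : ℕ}

/-- The law of a tuple of independent Haar unitary matrices. -/
abbrev haarTuple (ι : Type*) [Fintype ι] (N : ℕ) :
    Measure (ι → Matrix.unitaryGroup (Fin N) ℂ) :=
  Measure.pi fun _ => haarUnitary N

/-- The law of a tuple of independent Gaussian matrices. -/
abbrev gaussianTuple (ι : Type*) [Fintype ι] (N : ℕ) : Measure (ι → Matrix (Fin N) (Fin N) ℂ) :=
  Measure.pi fun _ => gaussianMatrixLaw N

theorem integral_id_gaussianTuple : (gaussianTuple ι N)[id] = 0 :=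
  (integral_pi_comp (IsGaussian.integrable_id (μ := gaussianMatrixLaw N))).trans
    (funext fun _ => integral_id_gaussianMatrixLaw)

theorem measurePreserving_unitary_mul_abs_tuple :
    MeasurePreserving (fun (z : (ι → Matrix.unitaryGroup (Fin N) ℂ) ×
        (ι → Matrix (Fin N) (Fin N) ℂ)) i => (z.1 i).1 * CFC.abs (z.2 i))
      ((haarTuple ι N).prod (gaussianTuple ι N)) (gaussianTuple ι N) :=
  (measurePreserving_pi (fun _ : ι => (haarUnitary N).prod (gaussianMatrixLaw N)) _
    fun _ => measurePreserving_unitary_mul_abs).comp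
    (measurePreserving_arrowProdEquivProdArrow (Matrix.unitaryGroup (Fin N) ℂ)
      (Matrix (Fin N) (Fin N) ℂ) ι (fun _ => haarUnitary N) fun _ => gaussianMatrixLaw N).symm

/-- `(x, y) ↦ (xᵢ ⊗ ȳᵢ)ᵢ`, which is bilinear over the reals only. -/
def tensorConjTuple (ι : Type*) [Fintype ι] (N : ℕ) :
    (ι → Matrix (Fin N) (Fin N) ℂ) →L[ℝ] (ι → Matrix (Fin N) (Fin N) ℂ) →L[ℝ]
      (ι → Matrix (Fin N × Fin N) (Fin N × Fin N) ℂ) :=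
  LinearMap.toContinuousBilinearMap <| LinearMap.mk₂ ℝ
    (fun x y i => tensorConjBilin N (x i) (y i))
    (fun x x' y => by ext1; simp) (fun c x y => by ext1; simp)
    (fun x y y' => by ext1; simp) (fun c x y => by ext1; simp)

theorem integral_tensorConjTuple_self :
    ∫ Y, tensorConjTuple ι N Y Y ∂gaussianTuple ι N = fun _ => projId N :=
  (integral_pi_comp integrable_tensorConj_self).trans (by rw [integral_tensorConj_self])

/-- Right multiplication of each matrix of a tuple by `1 - P`. -/
def compress (ι : Type*) [Fintype ι] (N : ℕ) :
    (ι → Matrix (Fin N × Fin N) (Fin N × Fin N) ℂ) →L[ℝ]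
      (ι → Matrix (Fin N × Fin N) (Fin N × Fin N) ℂ) :=
  LinearMap.toContinuousLinearMap (LinearMap.mulRight ℝ fun _ => 1 - projId N)

theorem compress_projId : compress ι N (fun _ => projId N) = 0 :=
  funext fun _ => isStarProjection_projId.isIdempotentElem.mul_one_sub_self

theorem integral_compress_unitary_mul_abs {c : ℝ}
    (hc : meanAbs N * (1 - projId N) = c • (1 - projId N)) (u : ι → Matrix (Fin N) (Fin N) ℂ) :
    ∫ Y, compress ι N (tensorConjTuple ι N (fun i => u i * CFC.abs (Y i))
        fun i => u i * CFC.abs (Y i)) ∂gaussianTuple ι N =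
      c • compress ι N (tensorConjTuple ι N u u) := by
  have hA := integrable_pi_comp (ι := ι) (integrable_tensorConj_abs (N := N))
  calc _ = ∫ Y, compress ι N (tensorConjTuple ι N u u *
        fun i => tensorConj (CFC.abs (Y i)) (CFC.abs (Y i))) ∂gaussianTuple ι N := by
        refine integral_congr_ae (.of_forall fun Y => congrArg _ (funext fun i => ?_))
        exact (tensorConj_mul_tensorConj _ _ _ _).symm
    _ = compress ι N (tensorConjTuple ι N u u * fun _ => meanAbs N) := by
        rw [(compress ι N).integral_comp_comm (hA.const_mul _),
          integral_const_mul_of_integrable hA, integral_pi_comp integrable_tensorConj_abs, meanAbs]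
    _ = c • compress ι N (tensorConjTuple ι N u u) := funext fun i => by
        change tensorConj (u i) (u i) * meanAbs N * (1 - projId N) = c • (_ * _)
        rw [mul_assoc, hc]
        exact mul_smul_comm _ _ _

variable (F : Seminorm ℝ (ι → Matrix (Fin N × Fin N) (Fin N × Fin N) ℂ)) {p : ℝ}

theorem integrable_seminorm_tensorConjTuple_prod (hp : 1 ≤ p) :
    Integrable (fun z => F (tensorConjTuple ι N z.1 z.2) ^ p)
      ((gaussianTuple ι N).prod (gaussianTuple ι N)) :=
  integrable_seminorm_bilinear_rpow (tensorConjTuple ι N) F hp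

theorem integrable_seminorm_tensorConjTuple_haar (hp : 1 ≤ p) :
    Integrable (fun U => F (tensorConjTuple ι N (fun i => (U i).1) fun i => (U i).1) ^ p)
      (haarTuple ι N) :=
  ((continuous_seminorm_rpow F hp).comp (by fun_prop)).integrable_of_hasCompactSupport
    (.of_compactSpace _)

theorem integral_seminorm_compress_self_le (hp : 1 ≤ p) (hF : ∀ x, F (compress ι N x) ≤ F x) :
    ∫ Y, F (compress ι N (tensorConjTuple ι N Y Y)) ^ p ∂gaussianTuple ι N ≤
      2 ^ p * ∫ z, F (tensorConjTuple ι N z.1 z.2) ^ p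
        ∂(gaussianTuple ι N).prod (gaussianTuple ι N) := by
  have compress_centered (Y : ι → Matrix (Fin N) (Fin N) ℂ) :
      compress ι N (tensorConjTuple ι N Y Y) = compress ι N (tensorConjTuple ι N Y Y -
        ∫ Y', tensorConjTuple ι N Y' Y' ∂gaussianTuple ι N) := by
    rw [integral_tensorConjTuple_self, map_sub, compress_projId, sub_zero]
  have integrable_centered : Integrable (fun Y => F (tensorConjTuple ι N Y Y -
      ∫ Y', tensorConjTuple ι N Y' Y' ∂gaussianTuple ι N) ^ p) (gaussianTuple ι N) :=
    integrable_seminorm_rpow F hp ((memLp_bilinear_of_isGaussian (tensorConjTuple ι N)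
      (.id ℝ _) (.id ℝ _) ENNReal.ofReal_ne_top).sub (memLp_const _))
  simp only [compress_centered]
  calc _ ≤ _ := integral_mono_of_nonneg (.of_forall fun _ => by positivity) integrable_centered
          (.of_forall fun Y => Real.rpow_le_rpow (apply_nonneg F _) (hF _) (by positivity))
    _ ≤ _ := integral_seminorm_sub_integral_rpow_le integral_id_gaussianTuple _ F hp

theorem rpow_mul_integral_seminorm_haar_le (hp : 1 ≤ p) {c : ℝ} (hc₀ : 0 ≤ c)
    (hc : meanAbs N * (1 - projId N) = c • (1 - projId N)) :
    c ^ p * ∫ U, F (compress ι N (tensorConjTuple ι N (fun i => (U i).1) fun i => (U i).1)) ^ p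
        ∂haarTuple ι N ≤
      ∫ Y, F (compress ι N (tensorConjTuple ι N Y Y)) ^ p ∂gaussianTuple ι N := by
  let X (Y : ι → Matrix (Fin N) (Fin N) ℂ) := compress ι N (tensorConjTuple ι N Y Y)
  have hX {r : ℝ≥0∞} (hr : r ≠ ∞) : MemLp X r (gaussianTuple ι N) :=
    (compress ι N).comp_memLp'
      (memLp_bilinear_of_isGaussian (tensorConjTuple ι N) (.id ℝ _) (.id ℝ _) hr)
  have hFX : Integrable (fun Y => F (X Y) ^ p) (gaussianTuple ι N) :=
    integrable_seminorm_rpow F hp (hX ENNReal.ofReal_ne_top)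
  have hmp := measurePreserving_unitary_mul_abs_tuple (ι := ι) (N := N)
  calc _ = ∫ U, F (∫ Y, X (fun i => (U i).1 * CFC.abs (Y i)) ∂gaussianTuple ι N) ^ p
          ∂haarTuple ι N := by
        simp only [X, integral_compress_unitary_mul_abs hc, map_smul_eq_mul,
          Real.norm_of_nonneg hc₀, Real.mul_rpow hc₀ (apply_nonneg F _), integral_const_mul]
    _ ≤ ∫ z, F (X fun i => (z.1 i).1 * CFC.abs (z.2 i)) ^ p
          ∂(haarTuple ι N).prod (gaussianTuple ι N) :=
        integral_seminorm_rpow_integral_le F hp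
          (hmp.integrable_comp_of_integrable
            (memLp_one_iff_integrable.mp (hX ENNReal.one_ne_top)))
          (hmp.integrable_comp_of_integrable hFX)
    _ = ∫ Y, F (X Y) ^ p ∂gaussianTuple ι N := by
        have h := integral_map hmp.aemeasurable (hmp.map_eq ▸ hFX.aestronglyMeasurable)
        rw [hmp.map_eq] at h
        exact h.symm

theorem integral_seminorm_haar_le (hp : 1 ≤ p) (hF : ∀ x, F (compress ι N x) ≤ F x) :
    ∫ U, F (compress ι N (tensorConjTuple ι N (fun i => (U i).1) fun i => (U i).1)) ^ p
        ∂haarTuple ι N ≤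
      8 ^ p * ∫ z, F (tensorConjTuple ι N z.1 z.2) ^ p
        ∂(gaussianTuple ι N).prod (gaussianTuple ι N) := by
  obtain ⟨c, hc₀, hc⟩ := exists_meanAbs_mul_one_sub_projId_eq N
  calc _ ≤ 4 ^ p * (c ^ p * ∫ U, F (compress ι N (tensorConjTuple ι N (fun i => (U i).1)
          fun i => (U i).1)) ^ p ∂haarTuple ι N) := by
        rw [← mul_assoc, ← Real.mul_rpow (by positivity) (by positivity)]
        refine le_mul_of_one_le_left (by positivity) (Real.one_le_rpow ?_ (by positivity))
        linarith
    _ ≤ 4 ^ p * (2 ^ p * ∫ z, F (tensorConjTuple ι N z.1 z.2) ^ p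
          ∂(gaussianTuple ι N).prod (gaussianTuple ι N)) := by
        gcongr 4 ^ p * ?_
        exact (rpow_mul_integral_seminorm_haar_le F hp (by linarith) hc).trans
          (integral_seminorm_compress_self_le F hp hF)
    _ = _ := by
        rw [← mul_assoc, ← Real.mul_rpow (by positivity) (by positivity)]
        norm_num

end Comparison

section RandomVariables

variable {ι : Type*} [Fintype ι] {N : ℕ} {Ω : Type*} [MeasurableSpace Ω] {μ : Measure Ω}

theorem hasLaw_gaussianTuple_prod {Y Y' : ι → Ω → Matrix (Fin N) (Fin N) ℂ}
    (hY : ∀ i, HasLaw (Y i) (gaussianMatrixLaw N) μ)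
    (hY' : ∀ i, HasLaw (Y' i) (gaussianMatrixLaw N) μ) (hind : iIndepFun (Sum.elim Y Y') μ) :
    HasLaw (fun ω => (fun i => Y i ω, fun i => Y' i ω))
      ((gaussianTuple ι N).prod (gaussianTuple ι N)) μ :=
  (measurePreserving_sumPiEquivProdPi fun _ : ι ⊕ ι => gaussianMatrixLaw N).comp_hasLaw
    (hind.hasLaw_pi (Sum.rec hY hY'))

theorem integral_seminorm_tensorConj_le
    (F : Seminorm ℝ (ι → Matrix (Fin N × Fin N) (Fin N × Fin N) ℂ))
    (hF : ∀ x, F (compress ι N x) ≤ F x) {p : ℝ} (hp : 1 ≤ p)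
    {U : ι → Ω → Matrix.unitaryGroup (Fin N) ℂ} {Y Y' : ι → Ω → Matrix (Fin N) (Fin N) ℂ}
    (hU : ∀ i, HasLaw (U i) (haarUnitary N) μ) (hindU : iIndepFun U μ)
    (hY : ∀ i, HasLaw (Y i) (gaussianMatrixLaw N) μ)
    (hY' : ∀ i, HasLaw (Y' i) (gaussianMatrixLaw N) μ) (hind : iIndepFun (Sum.elim Y Y') μ) :
    Integrable (fun ω => F (fun i => tensorConj (U i ω).1 (U i ω).1 * (1 - projId N)) ^ p) μ ∧
    Integrable (fun ω => F (fun i => tensorConj (Y i ω) (Y' i ω)) ^ p) μ ∧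
    ∫ ω, F (fun i => tensorConj (U i ω).1 (U i ω).1 * (1 - projId N)) ^ p ∂μ ≤
      8 ^ p * ∫ ω, F (fun i => tensorConj (Y i ω) (Y' i ω)) ^ p ∂μ := by
  have lawU : HasLaw (fun ω i => U i ω) (haarTuple ι N) μ := hindU.hasLaw_pi hU
  have lawY := hasLaw_gaussianTuple_prod hY hY' hind
  have hFU := integrable_seminorm_tensorConjTuple_haar (F.comp (compress ι N).toLinearMap) hp
  simp only [Seminorm.comp_apply, ContinuousLinearMap.coe_coe] at hFU
  have hFY := integrable_seminorm_tensorConjTuple_prod F hp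
  have main := integral_seminorm_haar_le F hp hF
  rw [← lawU.map_eq] at hFU main
  rw [← lawY.map_eq] at hFY main
  rw [integral_map lawU.aemeasurable hFU.aestronglyMeasurable,
    integral_map lawY.aemeasurable hFY.aestronglyMeasurable] at main
  exact ⟨hFU.comp_aemeasurable lawU.aemeasurable, hFY.comp_aemeasurable lawY.aemeasurable, main⟩

end RandomVariables

section Coefficients

variable {ι k m : Type*} [Fintype ι]

/-- `x ↦ ∑ᵢ aᵢ xᵢ` for scalar coefficients `aᵢ`. -/
def scalarCombination (a : ι → ℂ) : (ι → Matrix m m ℂ) →ₗ[ℂ] Matrix m m ℂ where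
  toFun x := ∑ i, a i • x i
  map_add' x y := by simp only [Pi.add_apply, smul_add, Finset.sum_add_distrib]
  map_smul' c x := by
    simp only [Pi.smul_apply, RingHom.id_apply, Finset.smul_sum, smul_comm c]

/-- `x ↦ ∑ᵢ aᵢ ⊗ xᵢ` for matrix coefficients `aᵢ`. -/
def kroneckerCombination (a : ι → Matrix k k ℂ) :
    (ι → Matrix m m ℂ) →ₗ[ℂ] Matrix (k × m) (k × m) ℂ where
  toFun x := ∑ i, a i ⊗ₖ x i
  map_add' x y := by simp only [Pi.add_apply, Matrix.kronecker_add, Finset.sum_add_distrib]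
  map_smul' c x := by
    simp only [Pi.smul_apply, RingHom.id_apply, Finset.smul_sum, Matrix.kronecker_smul]

variable {N : ℕ} {q : ℝ≥0∞} [Fact (1 ≤ q)]

theorem schattenNorm_scalarCombination_compress_le (a : ι → ℂ)
    (x : ι → Matrix (Fin N × Fin N) (Fin N × Fin N) ℂ) :
    schattenNorm q (scalarCombination a (compress ι N x)) ≤
      schattenNorm q (scalarCombination a x) := by
  have h : scalarCombination a (compress ι N x) = scalarCombination a x * (1 - projId N) := by
    change ∑ i, a i • (x i * (1 - projId N)) = (∑ i, a i • x i) * (1 - projId N)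
    simp only [Finset.sum_mul, smul_mul_assoc]
  rw [h]
  exact schattenNorm_mul_le_of_isStarProjection _ isStarProjection_projId.one_sub

variable [Fintype k] [DecidableEq k]

theorem isStarProjection_one_kronecker [Fintype m] {e : Matrix m m ℂ} (he : IsStarProjection e) :
    IsStarProjection ((1 : Matrix k k ℂ) ⊗ₖ e) where
  isIdempotentElem := by
    rw [IsIdempotentElem, ← Matrix.mul_kronecker_mul, one_mul, he.isIdempotentElem.eq]
  isSelfAdjoint := by
    rw [IsSelfAdjoint, Matrix.star_eq_conjTranspose, Matrix.conjTranspose_kronecker,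
      Matrix.conjTranspose_one, ← Matrix.star_eq_conjTranspose, he.isSelfAdjoint.star_eq]

theorem schattenNorm_kroneckerCombination_compress_le (a : ι → Matrix k k ℂ)
    (x : ι → Matrix (Fin N × Fin N) (Fin N × Fin N) ℂ) :
    schattenNorm q (kroneckerCombination a (compress ι N x)) ≤
      schattenNorm q (kroneckerCombination a x) := by
  have h : kroneckerCombination a (compress ι N x) =
      kroneckerCombination a x * ((1 : Matrix k k ℂ) ⊗ₖ (1 - projId N)) := by
    change ∑ i, a i ⊗ₖ (x i * (1 - projId N)) = (∑ i, a i ⊗ₖ x i) * _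
    simp only [Finset.sum_mul, ← Matrix.mul_kronecker_mul, mul_one]
  rw [h]
  exact schattenNorm_mul_le_of_isStarProjection _
    (isStarProjection_one_kronecker isStarProjection_projId.one_sub)

end Coefficients

end RandomUnitary

end

theorem mainTheorem5 :
    ∃ C : ℝ, 0 < C ∧
      ∀ (N n : ℕ), 1 ≤ N →
      ∀ {Ω : Type*} [MeasurableSpace Ω] (μ : Measure Ω) [IsProbabilityMeasure μ]
        (U : Fin n → Ω → Matrix.unitaryGroup (Fin N) ℂ)
        (Y Y' : Fin n → Ω → Matrix (Fin N) (Fin N) ℂ),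
        -- the `U j` are i.i.d. and uniformly distributed on the unitary group
        (∀ j, HasLaw (U j) (haarUnitary N) μ) → iIndepFun U μ →
        -- the `Y j` and `Y' j` are, all together, i.i.d. Gaussian matrices
        (∀ j, HasLaw (Y j) (gaussianMatrixLaw N) μ) →
        (∀ j, HasLaw (Y' j) (gaussianMatrixLaw N) μ) →
        iIndepFun (Sum.elim Y Y') μ →
        ∀ (p : ℝ) (q : ℝ≥0∞), 1 ≤ p → 1 ≤ q →
          -- scalar coefficients
          (∀ a : Fin n → ℂ,
            Integrable (fun ω => schattenNorm q
              (∑ j, a j • (tensorConj (U j ω).1 (U j ω).1 * (1 - projId N))) ^ p) μ ∧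
            Integrable (fun ω => schattenNorm q
              (∑ j, a j • tensorConj (Y j ω) (Y' j ω)) ^ p) μ ∧
            ∫ ω, schattenNorm q
                (∑ j, a j • (tensorConj (U j ω).1 (U j ω).1 * (1 - projId N))) ^ p ∂μ ≤
              C ^ p * ∫ ω, schattenNorm q
                (∑ j, a j • tensorConj (Y j ω) (Y' j ω)) ^ p ∂μ) ∧
          -- matrix coefficients
          (∀ (k : ℕ) (a : Fin n → Matrix (Fin k) (Fin k) ℂ),
            Integrable (fun ω => schattenNorm q
              (∑ j, a j ⊗ₖ (tensorConj (U j ω).1 (U j ω).1 * (1 - projId N))) ^ p) μ ∧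
            Integrable (fun ω => schattenNorm q
              (∑ j, a j ⊗ₖ tensorConj (Y j ω) (Y' j ω)) ^ p) μ ∧
            ∫ ω, schattenNorm q
                (∑ j, a j ⊗ₖ (tensorConj (U j ω).1 (U j ω).1 * (1 - projId N))) ^ p ∂μ ≤
              C ^ p * ∫ ω, schattenNorm q
                (∑ j, a j ⊗ₖ tensorConj (Y j ω) (Y' j ω)) ^ p ∂μ) := by
  refine ⟨8, by norm_num, ?_⟩
  intro N n _ Ω _ μ _ U Y Y' hU hindU hY hY' hind p q hp hq
  have : Fact (1 ≤ q) := ⟨hq⟩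
  refine ⟨fun a => ?_, fun k a => ?_⟩
  · exact integral_seminorm_tensorConj_le
      (((schattenSeminorm q _).comp (scalarCombination a)).restrictScalars ℝ)
      (schattenNorm_scalarCombination_compress_le a) hp hU hindU hY hY' hind
  · exact integral_seminorm_tensorConj_le
      (((schattenSeminorm q _).comp (kroneckerCombination a)).restrictScalars ℝ)
      (schattenNorm_kroneckerCombination_compress_le a) hp hU hindU hY hY' hind
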